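/- Let $n\ge 0$, $T>0$, and consider the third order operator with coefficients depending only on time $$\partial_t^3+\sum_{j=0}^{2}\ \sum_{|\alpha|\le 3-j}a_{j,\alpha}(t)\,\partial_t^j\partial_x^\alpha ,\qquad t\in[0,T],\ x\in\mathbb R^n ,$$ where the complex-valued coefficients $a_{j,\alpha}$ are (real-)analytic in a neighbourhood of $[0,T]$. Put $$L(t,\tau,\xi)=\tau^3+\sum_{j\le 2,\ j+|\alpha|=3}a_{j,\alpha}(t)\tau^j\xi^\alpha,\quad M(t,\tau,\xi)=\sum_{j+|\alpha|=2}a_{j,\alpha}(t)\tau^j\xi^\alpha,\quad N(t,\tau,\xi)=\sum_{j+|\alpha|=1}a_{j,\alpha}(t)\tau^j\xi^\alpha ,$$ and assume weak hyperbolicity: for all $t\in[0,T]$ and $\xi\in\mathbb R^n$ all roots $\tau$ of $L(t,\cdot,\xi)$ are real. Define $$\mathcal L=L-\partial_\tau^2L,\qquad \check M=M-\tfrac12\partial_t\partial_\tau L,\qquad \check N=N-\tfrac12\partial_t\partial_\tau M+\tfrac1{12}\partial_t^2\partial_\tau^2L .$$ Then, for all $t\in[0,T]$ and $\xi\in\mathbb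 R^n$, the roots $\lambda_1(t,\xi)<\lambda_2(t,\xi)<\lambda_3(t,\xi)$ of $\mathcal L(t,\cdot,\xi)$ and the roots $\mu_1(t,\xi)<\mu_2(t,\xi)$ of $\partial_\tau\mathcal L(t,\cdot,\xi)$ are real and distinct, and for each $\xi$ they are analytic functions of $t\in[0,T]$. Moreover, with $S_2=\{(1,2),(2,3),(3,1)\}$: there is a constant $C>0$ such that for all $\xi\in\mathbb R^n$ $$\text{(E-1)}\quad \int_0^T\sum_{(j,k)\in S_2}\frac{|\partial_t\lambda_j(t,\xi)-\partial_t\lambda_k(t,\xi)|}{|\lambda_j(t,\xi)-\lambda_k(t,\xi)|}\,dt\le C\log(1+|\xi|),$$ $$\text{(E-2)}\quad \int_0^T\sum_{(j,k)\in S_2}\frac{|\partial_t^2\lambda_j(t,\xi)-\partial_t^2\lambda_k(t,\xi)|}{|\partial_t\lambda_j(t,\xi)-\partial_t\lambda_k(t,\xi)|+1}\,dt\le C\log(1+|\xi|);$$ and for every $R>0$ there is a constant $C>0$ such that for all $\xi\in\mathbb R^n$ with $|\xi|\ge R$ $$\text{(E-3)}\quad \int_0^T\sum_{j=1}^3\frac{\bigl|\partial_t\bigl[\check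 M(t,\lambda_j(t,\xi),\xi)\bigr]\bigr|}{|\check M(t,\lambda_j(t,\xi),\xi)|+1}\,dt\le C\log(1+|\xi|),$$ $$\text{(E-4)}\quad \int_0^T\sum_{j=1}^2\frac{\bigl|\partial_t\bigl[\check N(t,\mu_j(t,\xi),\xi)\bigr]\bigr|}{|\check N(t,\mu_j(t,\xi),\xi)|+1}\,dt\le C\log(1+|\xi|).$$ In particular all these integrals converge. -/

import Mathlib

open MeasureTheory

noncomputable section

namespace ThirdOrder

open Polynomial

/-- The coefficients `a j α t` of the third order operator
`∂ₜ³ + ∑_{j ≤ 2} ∑_{|α| ≤ 3 - j} a j α (t) ∂ₜʲ ∂ₓ^α` on `ℝⁿ`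
(the entries outside this range of indices are never used). -/
abbrev Coeffs (n : ℕ) : Type := ℕ → (Fin n → ℕ) → ℝ → ℂ

variable {n : ℕ}

/-- `∑_{|α| = k} a_{j,α}(t) ξ^α`. -/
def coeffSum (a : Coeffs n) (j k : ℕ) (t : ℝ) (ξ : EuclideanSpace ℝ (Fin n)) : ℂ :=
  ∑ α ∈ Finset.piAntidiag (Finset.univ : Finset (Fin n)) k,
    a j α t * ∏ i, (ξ i : ℂ) ^ α i

/-- The principal symbol `L(t,τ,ξ)`, as a polynomial in `τ`. -/
def symL (a : Coeffs n) (t : ℝ) (ξ : EuclideanSpace ℝ (Fin n)) : ℂ[X] :=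
  X ^ 3 + ∑ j ∈ Finset.range 3, C (coeffSum a j (3 - j) t ξ) * X ^ j

/-- The symbol `M(t,τ,ξ)` of the terms of order two. -/
def symM (a : Coeffs n) (t : ℝ) (ξ : EuclideanSpace ℝ (Fin n)) : ℂ[X] :=
  ∑ j ∈ Finset.range 3, C (coeffSum a j (2 - j) t ξ) * X ^ j

/-- The symbol `N(t,τ,ξ)` of the terms of order one. -/
def symN (a : Coeffs n) (t : ℝ) (ξ : EuclideanSpace ℝ (Fin n)) : ℂ[X] :=
  ∑ j ∈ Finset.range 2, C (coeffSum a j (1 - j) t ξ) * X ^ j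

/-- The coefficients of the operator are analytic on `[0,T]`
(that is, in a neighbourhood of each point of `[0,T]`). -/
def AnalyticCoeffs (a : Coeffs n) (T : ℝ) : Prop :=
  ∀ (j : ℕ) (α : Fin n → ℕ), j ≤ 2 → j + ∑ i, α i ≤ 3 →
    AnalyticOnNhd ℝ (a j α) (Set.Icc 0 T)

/-- Weak hyperbolicity: `L(t,·,ξ)` has only real roots. -/
def WeaklyHyperbolic (a : Coeffs n) (T : ℝ) : Prop :=
  ∀ t ∈ Set.Icc 0 T, ∀ (ξ : EuclideanSpace ℝ (Fin n)) (z : ℂ),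
    (symL a t ξ).eval z = 0 → z.im = 0

/-- The auxiliary polynomial `L - ∂_τ² L`. -/
def auxL (a : Coeffs n) (t : ℝ) (ξ : EuclideanSpace ℝ (Fin n)) : ℂ[X] :=
  symL a t ξ - derivative (derivative (symL a t ξ))

/-- For a polynomial with only real roots: the `k`-th root (`k = 0, 1, …`), the roots being listed
in increasing order with multiplicity. -/
def orderedRoot (p : ℂ[X]) (k : ℕ) : ℝ :=
  ((p.roots.map Complex.re).sort (· ≤ ·)).getD k 0

/-- The roots `λ₁ ≤ λ₂ ≤ λ₃` of the auxiliary polynomial. -/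
def lam (a : Coeffs n) (j : Fin 3) (t : ℝ) (ξ : EuclideanSpace ℝ (Fin n)) : ℝ :=
  orderedRoot (auxL a t ξ) j

/-- The roots `μ₁ ≤ μ₂` of the `τ`-derivative of the auxiliary polynomial. -/
def mu (a : Coeffs n) (j : Fin 2) (t : ℝ) (ξ : EuclideanSpace ℝ (Fin n)) : ℝ :=
  orderedRoot (derivative (auxL a t ξ)) j

/-- `M - (1/2) ∂ₜ ∂_τ L`. -/
def checkM (a : Coeffs n) (t : ℝ) (τ : ℂ) (ξ : EuclideanSpace ℝ (Fin n)) : ℂ :=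
  (symM a t ξ).eval τ - 1 / 2 * deriv (fun s => (derivative (symL a s ξ)).eval τ) t

/-- `N - (1/2) ∂ₜ ∂_τ M + (1/12) ∂ₜ² ∂_τ² L`. -/
def checkN (a : Coeffs n) (t : ℝ) (τ : ℂ) (ξ : EuclideanSpace ℝ (Fin n)) : ℂ :=
  (symN a t ξ).eval τ - 1 / 2 * deriv (fun s => (derivative (symM a s ξ)).eval τ) t
    + 1 / 12 * iteratedDeriv 2 (fun s => (derivative (derivative (symL a s ξ))).eval τ) t

/-- The pairs `(1,2), (2,3), (3,1)`, with indices shifted by one. -/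
def S2 : Finset (Fin 3 × Fin 3) := {(0, 1), (1, 2), (2, 0)}

/-- The logarithmic condition `∫₀ᵀ |F(t,ξ)| dt ≲ log (1 + |ξ|)`, uniformly for `ξ ∈ S`. -/
def LogCondition (T : ℝ) (S : Set (EuclideanSpace ℝ (Fin n)))
    (F : ℝ → EuclideanSpace ℝ (Fin n) → ℝ) : Prop :=
  (∀ ξ ∈ S, IntervalIntegrable (fun t => F t ξ) volume 0 T) ∧
  ∃ C : ℝ, 0 < C ∧ ∀ ξ ∈ S, ∫ t in (0 : ℝ)..T, |F t ξ| ≤ C * Real.log (1 + ‖ξ‖)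

/-- `∑ |∂ₜλⱼ - ∂ₜλₖ| / |λⱼ - λₖ|`. -/
def integrand1 (a : Coeffs n) (t : ℝ) (ξ : EuclideanSpace ℝ (Fin n)) : ℝ :=
  ∑ p ∈ S2, |deriv (fun s => lam a p.1 s ξ) t - deriv (fun s => lam a p.2 s ξ) t| /
    |lam a p.1 t ξ - lam a p.2 t ξ|

/-- `∑ |∂ₜ²λⱼ - ∂ₜ²λₖ| / (|∂ₜλⱼ - ∂ₜλₖ| + 1)`. -/
def integrand2 (a : Coeffs n) (t : ℝ) (ξ : EuclideanSpace ℝ (Fin n)) : ℝ :=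
  ∑ p ∈ S2, |iteratedDeriv 2 (fun s => lam a p.1 s ξ) t
      - iteratedDeriv 2 (fun s => lam a p.2 s ξ) t| /
    (|deriv (fun s => lam a p.1 s ξ) t - deriv (fun s => lam a p.2 s ξ) t| + 1)

/-- `∑ |∂ₜ [M̌(t,λⱼ(t,ξ),ξ)]| / (|M̌(t,λⱼ(t,ξ),ξ)| + 1)`. -/
def integrand3 (a : Coeffs n) (t : ℝ) (ξ : EuclideanSpace ℝ (Fin n)) : ℝ :=
  ∑ j : Fin 3, ‖deriv (fun s => checkM a s (lam a j s ξ) ξ) t‖ /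
    (‖checkM a t (lam a j t ξ) ξ‖ + 1)

/-- `∑ |∂ₜ [Ň(t,μⱼ(t,ξ),ξ)]| / (|Ň(t,μⱼ(t,ξ),ξ)| + 1)`. -/
def integrand4 (a : Coeffs n) (t : ℝ) (ξ : EuclideanSpace ℝ (Fin n)) : ℝ :=
  ∑ j : Fin 2, ‖deriv (fun s => checkN a s (mu a j s ξ) ξ) t‖ /
    (‖checkN a t (mu a j t ξ) ξ‖ + 1)

/-- The `λⱼ` and `μⱼ` really are the roots of the auxiliary polynomial and of its `τ`-derivative,
they are distinct, and they depend analytically on `t ∈ [0,T]`. -/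
def RootsRegular (a : Coeffs n) (T : ℝ) : Prop :=
  ∀ ξ : EuclideanSpace ℝ (Fin n),
    (∀ t ∈ Set.Icc 0 T,
      auxL a t ξ = ∏ j : Fin 3, (X - C (lam a j t ξ : ℂ)) ∧
      lam a 0 t ξ < lam a 1 t ξ ∧ lam a 1 t ξ < lam a 2 t ξ ∧
      derivative (auxL a t ξ) = C 3 * ∏ j : Fin 2, (X - C (mu a j t ξ : ℂ)) ∧
      mu a 0 t ξ < mu a 1 t ξ) ∧
    (∀ j : Fin 3, AnalyticOn ℝ (fun t => lam a j t ξ) (Set.Icc 0 T)) ∧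
    (∀ j : Fin 2, AnalyticOn ℝ (fun t => mu a j t ξ) (Set.Icc 0 T))

end ThirdOrder

end

/-!
Passing from `L` to `L - ∂_τ² L` separates the roots: they stay real, and both the gaps between them
and the discriminant are bounded below by absolute constants. Implicit differentiation divides only
by this discriminant, so the roots, their `t`-derivatives and polynomial expressions in them with
the coefficients of the operator all lie in an algebra of functions of `(t,ξ)` that is integral over
the fractions of finite sums `∑ b(t) p(ξ)`, with `b` analytic and `p` of polynomial growth.

A function `f` in this algebra grows at most polynomially in `ξ`. Moreover its zeros in `t` are
bounded in number uniformly in `ξ`: for the finite sums this is Rolle's theorem applied inductively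
to Wronskians, and zeros of an integral element are zeros of the lowest coefficient of an equation
for it that does not vanish identically. Since the algebra is stable under `∂ₜ`, `arsinh ∘ f` is
piecewise monotone with boundedly many pieces, hence
`∫ |∂ₜ f| / (|f| + 1) ≤ ∫ |∂ₜ (arsinh ∘ f)| ≤ C log (2 + |ξ|)`.

For (E-1) and (E-2) small `ξ` matter as well. There the numerators carry a factor `|ξ|`, because the
top order coefficients are homogeneous of positive degree in `ξ`.
-/

noncomputable section

namespace ThirdOrder

open Set Filter Topology

section ZeroBounds

/-- On `s` the function `f` vanishes identically or has at most `N` zeros. -/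
def ZeroBound (s : Set ℝ) (N : ℕ) (f : ℝ → ℝ) : Prop :=
  (∀ t ∈ s, f t = 0) ∨ {t ∈ s | f t = 0}.encard ≤ N

variable {s K : Set ℝ} {f b : ℝ → ℝ}

lemma ZeroBound.mono {N : ℕ} (h : ZeroBound K N f) (hsK : s ⊆ K) : ZeroBound s N f :=
  h.imp (fun h t ht => h t (hsK ht))
    fun h => h.trans' (encard_le_encard fun _ ht => ⟨hsK ht.1, ht.2⟩)

lemma ZeroBound.congr {N : ℕ} {g : ℝ → ℝ} (h : ZeroBound s N f)
    (hfg : ∀ t ∈ s, f t = 0 ↔ g t = 0) : ZeroBound s N g :=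
  h.imp (fun h t ht => (hfg t ht).1 (h t ht))
    fun h => h.trans' (encard_le_encard fun t ht => ⟨ht.1, (hfg t ht.1).2 ht.2⟩)

lemma exists_zeroBound_of_analyticOnNhd (hK : IsCompact K) (hK' : IsPreconnected K)
    (hf : AnalyticOnNhd ℝ f K) : ∃ N, ZeroBound K N f := by
  by_cases hfin : {t ∈ K | f t = 0}.Finite
  · exact ⟨_, Or.inr hfin.encard_eq_coe_toFinset_card.le⟩
  · obtain ⟨x, hx, hacc⟩ :=
      Set.Infinite.exists_accPt_of_subset_isCompact hfin hK fun t ht => ht.1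
    rw [accPt_iff_frequently_nhdsNE] at hacc
    exact ⟨0, Or.inl fun t ht => hf.eqOn_zero_of_preconnected_of_frequently_eq_zero hK' hx
      (hacc.mono fun y hy => hy.2) ht⟩

lemma encard_le_of_interleaved {α : Type*} [LinearOrder α] {A B : Set α}
    (h : ∀ x ∈ A, ∀ y ∈ A, x < y → ∃ z ∈ B, x < z ∧ z < y) : A.encard ≤ B.encard + 1 := by
  rcases B.finite_or_infinite with hB | hB
  · lift B to Finset α using hB
    by_contra! hlt
    obtain ⟨S, hSA, hS⟩ := exists_subset_encard_eq (Order.add_one_le_of_lt hlt)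
    lift S to Finset α using finite_of_encard_eq_coe (k := B.card + 1 + 1) (by simpa using hS)
    have hcard := Finset.card_le_of_interleaved (s := S) (t := B) fun x hx y hy hxy _ =>
      h x (hSA hx) y (hSA hy) hxy
    simp only [encard_coe_eq_coe_finsetCard] at hS
    norm_cast at hS
    omega
  · simp [hB.encard_eq]

lemma deriv_mul_sub_eq_zero_iff_deriv_div {t : ℝ} (hf : DifferentiableAt ℝ f t)
    (hb : DifferentiableAt ℝ b t) (hbt : b t ≠ 0) :
    deriv f t * b t - f t * deriv b t = 0 ↔ deriv (fun s => f s / b s) t = 0 := by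
  rw [deriv_fun_div hf hb hbt, div_eq_zero_iff, or_iff_left (pow_ne_zero 2 hbt)]

lemma exists_wronskian_eq_zero {x y : ℝ} (hxy : x < y)
    (hf : ∀ t ∈ Icc x y, DifferentiableAt ℝ f t) (hb : ∀ t ∈ Icc x y, DifferentiableAt ℝ b t)
    (hb0 : ∀ t ∈ Icc x y, b t ≠ 0) (hx : f x = 0) (hy : f y = 0) :
    ∃ z ∈ Ioo x y, deriv f z * b z - f z * deriv b z = 0 := by
  obtain ⟨z, hz, h⟩ := exists_deriv_eq_zero (f := fun t => f t / b t) hxy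
    (fun t ht => ((hf t ht).div (hb t ht) (hb0 t ht)).continuousAt.continuousWithinAt)
    (by simp [hx, hy])
  have hz' := Ioo_subset_Icc_self hz
  exact ⟨z, hz, (deriv_mul_sub_eq_zero_iff_deriv_div (hf z hz') (hb z hz') (hb0 z hz')).2 h⟩

lemma eqOn_zero_of_wronskian_eq_zero (hs : IsOpen s) (hs' : IsPreconnected s)
    (hf : AnalyticOnNhd ℝ f s) (hb : AnalyticOnNhd ℝ b s)
    (hW : ∀ t ∈ s, deriv f t * b t - f t * deriv b t = 0)
    {t : ℝ} (ht : t ∈ s) (hft : f t = 0) (hbt : b t ≠ 0) : ∀ u ∈ s, f u = 0 := by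
  refine hf.eqOn_zero_of_preconnected_of_eventuallyEq_zero hs' ht ?_
  obtain ⟨ε, hε, hball⟩ := Metric.eventually_nhds_iff_ball.1
    ((hs.eventually_mem ht).and ((hb t ht).continuousAt.eventually_ne hbt))
  have hquot : ∀ u ∈ Metric.ball t ε, DifferentiableAt ℝ (fun s => f s / b s) u ∧
      deriv (fun s => f s / b s) u = 0 := fun u hu => by
    obtain ⟨hus, hbu⟩ := hball u hu
    have hfu := (hf u hus).differentiableAt
    have hbu' := (hb u hus).differentiableAt
    exact ⟨hfu.div hbu' hbu, (deriv_mul_sub_eq_zero_iff_deriv_div hfu hbu' hbu).1 (hW u hus)⟩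
  filter_upwards [Metric.ball_mem_nhds t hε] with u hu
  have hconst : f u / b u = f t / b t := Metric.isOpen_ball.is_const_of_deriv_eq_zero
    (f := fun s => f s / b s) (convex_ball t ε).isPreconnected
    (fun v hv => (hquot v hv).1.differentiableWithinAt) (fun v hv => (hquot v hv).2) hu
    (Metric.mem_ball_self hε)
  simpa [hft, (hball u hu).2] using hconst

lemma ZeroBound.of_wronskian {B W : ℕ} (hs : IsOpen s) (hs' : IsPreconnected s)
    (hf : AnalyticOnNhd ℝ f s) (hb : AnalyticOnNhd ℝ b s)
    (hbne : ¬ ∀ t ∈ s, b t = 0) (hB : ZeroBound s B b)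
    (hW : ZeroBound s W fun t => deriv f t * b t - f t * deriv b t) :
    ZeroBound s (B + (B + W + 1)) f := by
  have hB' := hB.resolve_left hbne
  have hsplit : {t ∈ s | f t = 0} ⊆ {t ∈ s | b t = 0} ∪ {t ∈ s | f t = 0 ∧ b t ≠ 0} :=
    fun t ⟨ht, hft⟩ => (em (b t = 0)).imp (fun hbt => ⟨ht, hbt⟩) fun hbt => ⟨ht, hft, hbt⟩
  rcases hW with hW | hW
  · by_cases h : ∃ t ∈ s, f t = 0 ∧ b t ≠ 0
    · obtain ⟨t, ht, hft, hbt⟩ := h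
      exact Or.inl (eqOn_zero_of_wronskian_eq_zero hs hs' hf hb hW ht hft hbt)
    · have hle : {t ∈ s | f t = 0} ⊆ {t ∈ s | b t = 0} := fun t ⟨ht, hft⟩ =>
        ⟨ht, by_contra fun hbt => h ⟨t, ht, hft, hbt⟩⟩
      exact Or.inr ((encard_le_encard hle).trans (hB'.trans (by norm_cast; omega)))
  · refine Or.inr ((encard_le_encard hsplit).trans ((encard_union_le _ _).trans ?_))
    push_cast
    refine add_le_add hB' ((encard_le_of_interleaved fun x hx y hy hxy => ?_).trans
      (add_le_add_left ((encard_union_le _ _).trans (add_le_add hB' hW)) 1))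
    have hsub : Icc x y ⊆ s := hs'.ordConnected.out hx.1 hy.1
    by_cases hbz : ∃ z ∈ Ioo x y, b z = 0
    · obtain ⟨z, hz, hz0⟩ := hbz
      exact ⟨z, Or.inl ⟨hsub (Ioo_subset_Icc_self hz), hz0⟩, hz⟩
    · have hb0 : ∀ t ∈ Icc x y, b t ≠ 0 := by
        intro t ht h0
        rcases eq_endpoints_or_mem_Ioo_of_mem_Icc ht with rfl | rfl | ht'
        exacts [hx.2.2 h0, hy.2.2 h0, hbz ⟨t, ht', h0⟩]
      obtain ⟨z, hz, hz0⟩ := exists_wronskian_eq_zero hxy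
        (fun t ht => (hf t (hsub ht)).differentiableAt)
        (fun t ht => (hb t (hsub ht)).differentiableAt) hb0 hx.2.1 hy.2.1
      exact ⟨z, Or.inr ⟨hsub (Ioo_subset_Icc_self hz), hz0⟩, hz⟩

theorem exists_zeroBound_sum {ι : Type*} (hK : IsCompact K) (hs : IsOpen s)
    (hs' : IsPreconnected s) (hK' : IsPreconnected K) (hsK : s ⊆ K) (S : Finset ι)
    (b : ι → ℝ → ℝ) (hb : ∀ k, AnalyticOnNhd ℝ (b k) K) :
    ∃ N, ∀ c : ι → ℝ, ZeroBound s N fun t => ∑ k ∈ S, c k * b k t := by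
  classical
  induction S using Finset.induction_on generalizing b with
  | empty => exact ⟨0, fun c => Or.inl (by simp)⟩
  | insert i S hi ih =>
    by_cases h0 : ∀ t ∈ s, b i t = 0
    · obtain ⟨N, hN⟩ := ih b hb
      exact ⟨N, fun c => (hN c).congr fun t ht => by simp [Finset.sum_insert hi, h0 t ht]⟩
    obtain ⟨B, hB⟩ := exists_zeroBound_of_analyticOnNhd hK hK' (hb i)
    obtain ⟨W, hW⟩ := ih (fun k t => deriv (b k) t * b i t - b k t * deriv (b i) t)
      fun k => ((hb k).deriv.mul (hb i)).sub ((hb k).mul (hb i).deriv)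
    refine ⟨B + (B + W + 1), fun c => ZeroBound.of_wronskian hs hs'
      (Finset.analyticOnNhd_fun_sum _ fun k _ => analyticOnNhd_const.mul ((hb k).mono hsK))
      ((hb i).mono hsK) h0 (hB.mono hsK) ((hW c).congr fun t ht => Eq.congr_left ?_)⟩
    have hd : ∀ k, DifferentiableAt ℝ (b k) t := fun k => (hb k t (hsK ht)).differentiableAt
    rw [deriv_fun_sum fun k _ => (hd k).const_mul _]
    simp only [deriv_const_mul _ (hd _), Finset.sum_insert hi, add_mul, mul_sub,
      Finset.sum_sub_distrib, Finset.sum_mul, mul_assoc]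
    ring

end ZeroBounds

section TimeDerivative

variable {E F : Type*} [NormedAddCommGroup F] [NormedSpace ℝ F] {T : ℝ}

/-- The derivative of `g(t, ξ)` with respect to `t`. -/
def dt (g : ℝ → E → F) (t : ℝ) (ξ : E) : F := deriv (fun s => g s ξ) t

lemma dt_congr {f g : ℝ → E → F} (h : ∀ t ∈ Ioo 0 T, ∀ ξ, f t ξ = g t ξ) :
    ∀ t ∈ Ioo 0 T, ∀ ξ, dt f t ξ = dt g t ξ := fun _ ht ξ =>
  EventuallyEq.deriv_eq (mem_of_superset (isOpen_Ioo.mem_nhds ht) fun s hs => h s hs ξ)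

end TimeDerivative

variable {E : Type*} [NormedAddCommGroup E] {T : ℝ}

section PolynomialBounds

variable {s : Set ℝ} {f g : ℝ → E → ℝ}

/-- `f` is bounded by a polynomial in `‖ξ‖`, uniformly for `t ∈ s`. -/
def PolyBddOn (s : Set ℝ) (f : ℝ → E → ℝ) : Prop :=
  ∃ (C : ℝ) (m : ℕ), 0 ≤ C ∧ ∀ t ∈ s, ∀ ξ, |f t ξ| ≤ C * (1 + ‖ξ‖) ^ m

lemma PolyBddOn.mono_set {s' : Set ℝ} (hf : PolyBddOn s f) (h : s' ⊆ s) : PolyBddOn s' f :=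
  let ⟨C, m, hC, hf⟩ := hf
  ⟨C, m, hC, fun t ht => hf t (h ht)⟩

lemma PolyBddOn.mono (hf : PolyBddOn s f) (h : ∀ t ∈ s, ∀ ξ, |g t ξ| ≤ |f t ξ|) :
    PolyBddOn s g :=
  let ⟨C, m, hC, hf⟩ := hf
  ⟨C, m, hC, fun t ht ξ => (h t ht ξ).trans (hf t ht ξ)⟩

lemma PolyBddOn.of_bounded {C : ℝ} (h : ∀ t ∈ s, ∀ ξ, |f t ξ| ≤ C) : PolyBddOn s f :=
  ⟨|C|, 0, abs_nonneg _, fun t ht ξ => by simpa using (h t ht ξ).trans (le_abs_self C)⟩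

lemma polyBddOn_const (c : ℝ) : PolyBddOn s fun (_ : ℝ) (_ : E) => c :=
  .of_bounded fun _ _ _ => le_rfl

lemma PolyBddOn.add (hf : PolyBddOn s f) (hg : PolyBddOn s g) : PolyBddOn s (f + g) := by
  obtain ⟨C, m, hC, hf⟩ := hf
  obtain ⟨D, k, hD, hg⟩ := hg
  refine ⟨C + D, m + k, by positivity, fun t ht ξ => ?_⟩
  have h1 : 1 ≤ 1 + ‖ξ‖ := by linarith [norm_nonneg ξ]
  calc |f t ξ + g t ξ| ≤ C * (1 + ‖ξ‖) ^ m + D * (1 + ‖ξ‖) ^ k :=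
        (abs_add_le _ _).trans (add_le_add (hf t ht ξ) (hg t ht ξ))
    _ ≤ C * (1 + ‖ξ‖) ^ (m + k) + D * (1 + ‖ξ‖) ^ (m + k) := by
        gcongr <;> first | exact h1 | omega
    _ = (C + D) * (1 + ‖ξ‖) ^ (m + k) := by ring

lemma PolyBddOn.mul (hf : PolyBddOn s f) (hg : PolyBddOn s g) : PolyBddOn s (f * g) := by
  obtain ⟨C, m, hC, hf⟩ := hf
  obtain ⟨D, k, hD, hg⟩ := hg
  refine ⟨C * D, m + k, by positivity, fun t ht ξ => ?_⟩
  calc |f t ξ * g t ξ| = |f t ξ| * |g t ξ| := abs_mul _ _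
    _ ≤ (C * (1 + ‖ξ‖) ^ m) * (D * (1 + ‖ξ‖) ^ k) := by gcongr <;> solve_by_elim
    _ = C * D * (1 + ‖ξ‖) ^ (m + k) := by ring

lemma PolyBddOn.sum {ι : Type*} (S : Finset ι) {f : ι → ℝ → E → ℝ}
    (hf : ∀ i ∈ S, PolyBddOn s (f i)) : PolyBddOn s (∑ i ∈ S, f i) :=
  Finset.sum_induction f (PolyBddOn s) (fun _ _ => PolyBddOn.add) (polyBddOn_const 0) hf

end PolynomialBounds

section SeparatedSums

variable {f g : ℝ → E → ℝ}

variable (E T) in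
/-- The algebra of finite sums of products `b(t) p(ξ)`, with `b` analytic on `[0,T]` and `p`
polynomially bounded; there is no condition on the values for `t ∉ (0,T)`. -/
def sepAlg : Subalgebra ℝ (ℝ → E → ℝ) where
  carrier := {g | ∃ (ι : Type) (_ : Fintype ι) (b : ι → ℝ → ℝ) (p : ι → E → ℝ),
    (∀ k, AnalyticOnNhd ℝ (b k) (Icc 0 T)) ∧ (∀ k, PolyBddOn univ fun _ => p k) ∧
      ∀ t ∈ Ioo 0 T, ∀ ξ, g t ξ = ∑ k, b k t * p k ξ}
  add_mem' := by
    rintro f g ⟨ι, _, b, p, hb, hp, h⟩ ⟨ι', _, b', p', hb', hp', h'⟩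
    exact ⟨ι ⊕ ι', inferInstance, Sum.elim b b', Sum.elim p p', Sum.rec hb hb', Sum.rec hp hp',
      fun t ht ξ => by simp [h t ht ξ, h' t ht ξ]⟩
  mul_mem' := by
    rintro f g ⟨ι, _, b, p, hb, hp, h⟩ ⟨ι', _, b', p', hb', hp', h'⟩
    refine ⟨ι × ι', inferInstance, fun k => b k.1 * b' k.2, fun k => p k.1 * p' k.2,
      fun k => (hb _).mul (hb' _), fun k => (hp _).mul (hp' _), fun t ht ξ => ?_⟩
    simp only [Pi.mul_apply, h t ht ξ, h' t ht ξ, Finset.sum_mul_sum, Fintype.sum_prod_type]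
    exact Finset.sum_congr rfl fun i _ => Finset.sum_congr rfl fun j _ => by ring
  algebraMap_mem' r := ⟨Unit, inferInstance, fun _ _ => r, fun _ _ => 1,
    fun _ => analyticOnNhd_const, fun _ => polyBddOn_const 1, fun _ _ _ => by simp⟩

lemma mem_sepAlg_of_analyticOnNhd {b : ℝ → ℝ} (hb : AnalyticOnNhd ℝ b (Icc 0 T)) {p : E → ℝ}
    (hp : PolyBddOn univ fun _ => p) : (fun t ξ => b t * p ξ) ∈ sepAlg E T :=
  ⟨Unit, inferInstance, fun _ => b, fun _ => p, fun _ => hb, fun _ => hp, fun _ _ _ => by simp⟩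

lemma mem_sepAlg_of_eq_zero (h : ∀ t ∈ Ioo 0 T, ∀ ξ, g t ξ = 0) : g ∈ sepAlg E T :=
  ⟨Empty, inferInstance, Empty.elim, Empty.elim, nofun, nofun, by simpa using h⟩

lemma mem_congr_of_sepAlg_le {A : Subalgebra ℝ (ℝ → E → ℝ)} (hA : sepAlg E T ≤ A)
    {f : ℝ → E → ℝ} (hf : f ∈ A) (h : ∀ t ∈ Ioo 0 T, ∀ ξ, g t ξ = f t ξ) : g ∈ A := by
  have hdiff : g - f ∈ A := hA (mem_sepAlg_of_eq_zero fun t ht ξ => sub_eq_zero.2 (h t ht ξ))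
  simpa using add_mem hdiff hf

lemma analyticOnNhd_of_mem_sepAlg (hg : g ∈ sepAlg E T) (ξ : E) :
    AnalyticOnNhd ℝ (fun t => g t ξ) (Ioo 0 T) := by
  obtain ⟨ι, _, b, p, hb, -, h⟩ := hg
  have hsum : AnalyticOnNhd ℝ (fun t => ∑ k, b k t * p k ξ) (Ioo 0 T) :=
    Finset.analyticOnNhd_fun_sum _ fun k _ =>
      ((hb k).mono Ioo_subset_Icc_self).mul analyticOnNhd_const
  exact hsum.congr isOpen_Ioo fun t ht => (h t ht ξ).symm

lemma polyBddOn_of_mem_sepAlg (hg : g ∈ sepAlg E T) : PolyBddOn (Ioo 0 T) g := by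
  obtain ⟨ι, _, b, p, hb, hp, h⟩ := hg
  have hterm : ∀ k, PolyBddOn (Ioo 0 T) fun t ξ => b k t * p k ξ := fun k => by
    obtain ⟨C, hC⟩ := isCompact_Icc.exists_bound_of_continuousOn (hb k).continuousOn
    exact (PolyBddOn.of_bounded (f := fun t _ => b k t) (C := C)
      fun t ht _ => hC t (Ioo_subset_Icc_self ht)).mul ((hp k).mono_set (subset_univ _))
  exact (PolyBddOn.sum Finset.univ fun k _ => hterm k).mono fun t ht ξ => by
    simp [h t ht ξ, Finset.sum_apply]

lemma exists_zeroBound_of_mem_sepAlg (hg : g ∈ sepAlg E T) :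
    ∃ N, ∀ ξ, ZeroBound (Ioo 0 T) N fun t => g t ξ := by
  obtain ⟨ι, _, b, p, hb, -, h⟩ := hg
  obtain ⟨N, hN⟩ := exists_zeroBound_sum isCompact_Icc isOpen_Ioo isPreconnected_Ioo
    isPreconnected_Icc Ioo_subset_Icc_self Finset.univ b hb
  refine ⟨N, fun ξ => (hN fun k => p k ξ).congr fun t ht => ?_⟩
  simp only [h t ht ξ, mul_comm]

lemma dt_mem_sepAlg (hg : g ∈ sepAlg E T) : dt g ∈ sepAlg E T := by
  obtain ⟨ι, _, b, p, hb, hp, h⟩ := hg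
  refine ⟨ι, inferInstance, fun k => deriv (b k), p, fun k => (hb k).deriv, hp, fun t ht ξ => ?_⟩
  have hd : ∀ k, DifferentiableAt ℝ (b k) t :=
    fun k => (hb k t (Ioo_subset_Icc_self ht)).differentiableAt
  rw [dt_congr h t ht ξ, dt, deriv_fun_sum fun k _ => (hd k).mul_const _]
  simp only [deriv_mul_const (hd _)]

end SeparatedSums

section Fractions

variable {f g : ℝ → E → ℝ}

variable (E T) in
/-- The algebra of fractions of elements of `sepAlg E T` with denominator bounded below by a
positive constant; there is no condition on the values for `t ∉ (0,T)`. -/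
def fracAlg : Subalgebra ℝ (ℝ → E → ℝ) where
  carrier := {f | ∃ g ∈ sepAlg E T, ∃ u ∈ sepAlg E T, ∃ c : ℝ, 0 < c ∧
    ∀ t ∈ Ioo 0 T, ∀ ξ, c ≤ u t ξ ∧ f t ξ * u t ξ = g t ξ}
  add_mem' := by
    rintro f f' ⟨g, hg, u, hu, c, hc, h⟩ ⟨g', hg', u', hu', c', hc', h'⟩
    refine ⟨g * u' + g' * u, add_mem (mul_mem hg hu') (mul_mem hg' hu), u * u', mul_mem hu hu',
      c * c', by positivity, fun t ht ξ => ?_⟩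
    obtain ⟨⟨hcu, hfu⟩, hcu', hfu'⟩ := And.intro (h t ht ξ) (h' t ht ξ)
    simp only [Pi.add_apply, Pi.mul_apply]
    exact ⟨mul_le_mul hcu hcu' hc'.le (hc.le.trans hcu),
      by linear_combination u' t ξ * hfu + u t ξ * hfu'⟩
  mul_mem' := by
    rintro f f' ⟨g, hg, u, hu, c, hc, h⟩ ⟨g', hg', u', hu', c', hc', h'⟩
    refine ⟨g * g', mul_mem hg hg', u * u', mul_mem hu hu', c * c', by positivity,
      fun t ht ξ => ?_⟩
    obtain ⟨⟨hcu, hfu⟩, hcu', hfu'⟩ := And.intro (h t ht ξ) (h' t ht ξ)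
    simp only [Pi.mul_apply]
    exact ⟨mul_le_mul hcu hcu' hc'.le (hc.le.trans hcu), by rw [← hfu, ← hfu']; ring⟩
  algebraMap_mem' r := ⟨_, algebraMap_mem _ r, 1, one_mem _, 1, one_pos, fun _ _ _ => by simp⟩

lemma sepAlg_le_fracAlg : sepAlg E T ≤ fracAlg E T :=
  fun g hg => ⟨g, hg, 1, one_mem _, 1, one_pos, fun _ _ _ => by simp⟩

lemma inv_mem_fracAlg {u : ℝ → E → ℝ} (hu : u ∈ sepAlg E T) {c : ℝ} (hc : 0 < c)
    (h : ∀ t ∈ Ioo 0 T, ∀ ξ, c ≤ u t ξ) : u⁻¹ ∈ fracAlg E T :=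
  ⟨1, one_mem _, u, hu, c, hc, fun t ht ξ =>
    ⟨h t ht ξ, inv_mul_cancel₀ (hc.trans_le (h t ht ξ)).ne'⟩⟩

lemma analyticOnNhd_of_mem_fracAlg (hf : f ∈ fracAlg E T) (ξ : E) :
    AnalyticOnNhd ℝ (fun t => f t ξ) (Ioo 0 T) := by
  obtain ⟨g, hg, u, hu, c, hc, h⟩ := hf
  have hu0 : ∀ t ∈ Ioo 0 T, u t ξ ≠ 0 := fun t ht => (hc.trans_le (h t ht ξ).1).ne'
  have hquot : AnalyticOnNhd ℝ (fun t => g t ξ / u t ξ) (Ioo 0 T) :=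
    (analyticOnNhd_of_mem_sepAlg hg ξ).div (analyticOnNhd_of_mem_sepAlg hu ξ) hu0
  exact hquot.congr isOpen_Ioo fun t ht => ((eq_div_iff (hu0 t ht)).2 (h t ht ξ).2).symm

lemma polyBddOn_of_mem_fracAlg (hf : f ∈ fracAlg E T) : PolyBddOn (Ioo 0 T) f := by
  obtain ⟨g, hg, u, -, c, hc, h⟩ := hf
  refine ((polyBddOn_const c⁻¹).mul (polyBddOn_of_mem_sepAlg hg)).mono fun t ht ξ => ?_
  obtain ⟨hcu, hfu⟩ := h t ht ξ
  rw [Pi.mul_apply, Pi.mul_apply, ← hfu, abs_mul, abs_mul, abs_of_pos (hc.trans_le hcu),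
    abs_of_pos (inv_pos.2 hc), inv_mul_eq_div, le_div_iff₀ hc]
  exact mul_le_mul_of_nonneg_left hcu (abs_nonneg _)

lemma exists_zeroBound_of_mem_fracAlg (hf : f ∈ fracAlg E T) :
    ∃ N, ∀ ξ, ZeroBound (Ioo 0 T) N fun t => f t ξ := by
  obtain ⟨g, hg, u, -, c, hc, h⟩ := hf
  obtain ⟨N, hN⟩ := exists_zeroBound_of_mem_sepAlg hg
  refine ⟨N, fun ξ => (hN ξ).congr fun t ht => ?_⟩
  rw [← (h t ht ξ).2, mul_eq_zero, or_iff_left (hc.trans_le (h t ht ξ).1).ne']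

lemma dt_mem_fracAlg (hf : f ∈ fracAlg E T) : dt f ∈ fracAlg E T := by
  have hfa := analyticOnNhd_of_mem_fracAlg hf
  obtain ⟨g, hg, u, hu, c, hc, h⟩ := hf
  refine ⟨dt g * u - g * dt u, sub_mem (mul_mem (dt_mem_sepAlg hg) hu)
    (mul_mem hg (dt_mem_sepAlg hu)), u * u, mul_mem hu hu, c * c, by positivity,
    fun t ht ξ => ⟨mul_self_le_mul_self hc.le (h t ht ξ).1, ?_⟩⟩
  have hderiv : dt g t ξ = dt f t ξ * u t ξ + f t ξ * dt u t ξ := by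
    rw [← dt_congr (f := fun t ξ => f t ξ * u t ξ) (fun t ht ξ => (h t ht ξ).2) t ht ξ]
    exact deriv_fun_mul (hfa ξ t ht).differentiableAt
      (analyticOnNhd_of_mem_sepAlg hu ξ t ht).differentiableAt
  simp only [Pi.mul_apply, Pi.sub_apply, hderiv, ← (h t ht ξ).2]
  ring

end Fractions

variable {E : Type*} [NormedAddCommGroup E] {T : ℝ}

section IntegralElements

lemma abs_le_one_add_sum_of_monic_equation {d : ℕ} {c : ℕ → ℝ} {x : ℝ}
    (hx : x ^ d + ∑ i ∈ Finset.range d, c i * x ^ i = 0) :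
    |x| ≤ 1 + ∑ i ∈ Finset.range d, |c i| := by
  have hnn : 0 ≤ ∑ i ∈ Finset.range d, |c i| := Finset.sum_nonneg fun i _ => abs_nonneg _
  by_contra! hlt
  have hx1 : 1 < |x| := by linarith
  rcases d with _ | d
  · simp at hx
  have hpow : |x| * |x| ^ d ≤ (∑ i ∈ Finset.range (d + 1), |c i|) * |x| ^ d := by
    rw [← pow_succ', ← abs_pow, eq_neg_of_add_eq_zero_left hx, abs_neg, Finset.sum_mul]
    refine (Finset.abs_sum_le_sum_abs _ _).trans (Finset.sum_le_sum fun i hi => ?_)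
    rw [abs_mul, abs_pow]
    gcongr
    · exact hx1.le
    · exact Nat.lt_succ_iff.1 (Finset.mem_range.1 hi)
  have := le_of_mul_le_mul_right hpow (by positivity)
  linarith

lemma ZeroBound.of_polynomial_equation {s : Set ℝ} (hs : IsPreconnected s) {g : ℝ → ℝ}
    (hg : AnalyticOnNhd ℝ g s) {d : ℕ} {F : ℕ → ℝ → ℝ} {N : ℕ → ℕ}
    (hF : ∀ i, AnalyticOnNhd ℝ (F i) s) (hN : ∀ i, ZeroBound s (N i) (F i))
    (hd : ¬ ∀ t ∈ s, F d t = 0)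
    (h : ∀ t ∈ s, ∑ i ∈ Finset.range (d + 1), F i t * g t ^ i = 0) :
    ZeroBound s (∑ i ∈ Finset.range (d + 1), N i) g := by
  induction d generalizing F N with
  | zero => exact absurd (by simpa using h) hd
  | succ d ih =>
    rw [Finset.sum_range_succ']
    by_cases h0 : ∀ t ∈ s, F 0 t = 0
    · have hprod : ∀ t ∈ s, g t * ∑ i ∈ Finset.range (d + 1), F (i + 1) t * g t ^ i = 0 := by
        intro t ht
        rw [← h t ht, Finset.sum_range_succ' _ (d + 1), h0 t ht, zero_mul, add_zero,
          Finset.mul_sum]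
        exact Finset.sum_congr rfl fun i _ => by ring
      rcases AnalyticOnNhd.eq_zero_or_eq_zero_of_mul_eq_zero hg
        (Finset.analyticOnNhd_fun_sum _ fun i _ => (hF (i + 1)).mul (hg.pow i)) hprod hs
        with hg0 | hsum
      · exact Or.inl hg0
      · exact (ih (fun i => hF (i + 1)) (fun i => hN (i + 1)) hd hsum).imp_right fun hle =>
          hle.trans (by norm_cast; omega)
    · have hsub : {t ∈ s | g t = 0} ⊆ {t ∈ s | F 0 t = 0} := fun t ⟨ht, hgt⟩ => ⟨ht, by
        simpa [Finset.sum_range_succ', hgt] using h t ht⟩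
      exact Or.inr ((encard_le_encard hsub).trans
        (((hN 0).resolve_left h0).trans (by norm_cast; omega)))

variable {g : ℝ → E → ℝ}

lemma exists_equation_of_isIntegral (hg : IsIntegral (fracAlg E T) g) :
    ∃ (d : ℕ) (F : ℕ → ℝ → E → ℝ), (∀ i, F i ∈ fracAlg E T) ∧ F d = 1 ∧
      ∀ t ξ, ∑ i ∈ Finset.range (d + 1), F i t ξ * g t ξ ^ i = 0 := by
  obtain ⟨p, hp, h⟩ := hg
  refine ⟨p.natDegree, fun i => (p.coeff i : ℝ → E → ℝ), fun i => (p.coeff i).2, ?_,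
    fun t ξ => ?_⟩
  · exact congrArg Subtype.val (show p.coeff p.natDegree = 1 from hp)
  · rw [Polynomial.eval₂_eq_sum_range] at h
    simpa [Finset.sum_apply] using congrFun (congrFun h t) ξ

lemma polyBddOn_of_isIntegral (hg : IsIntegral (fracAlg E T) g) : PolyBddOn (Ioo 0 T) g := by
  obtain ⟨d, F, hF, hd, h⟩ := exists_equation_of_isIntegral hg
  have hsum : PolyBddOn (Ioo 0 T) ((fun _ _ => 1) + ∑ i ∈ Finset.range d, fun t ξ => |F i t ξ|) :=
    (polyBddOn_const 1).add (PolyBddOn.sum _ fun i _ =>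
      (polyBddOn_of_mem_fracAlg (hF i)).mono fun _ _ _ => by simp)
  refine hsum.mono fun t _ ξ => ?_
  have heq := h t ξ
  rw [Finset.sum_range_succ, hd, Pi.one_apply, Pi.one_apply, one_mul, add_comm] at heq
  simpa [Finset.sum_apply] using
    (abs_le_one_add_sum_of_monic_equation heq).trans (le_abs_self _)

lemma exists_zeroBound_of_isIntegral (hg : IsIntegral (fracAlg E T) g)
    (hga : ∀ ξ, AnalyticOnNhd ℝ (fun t => g t ξ) (Ioo 0 T)) :
    ∃ N, ∀ ξ, ZeroBound (Ioo 0 T) N fun t => g t ξ := by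
  obtain ⟨d, F, hF, hd, h⟩ := exists_equation_of_isIntegral hg
  choose N hN using fun i => exists_zeroBound_of_mem_fracAlg (hF i)
  refine ⟨∑ i ∈ Finset.range (d + 1), N i, fun ξ => ?_⟩
  rcases (Ioo 0 T).eq_empty_or_nonempty with hT | ⟨t₀, ht₀⟩
  · exact Or.inl (by simp [hT])
  · exact ZeroBound.of_polynomial_equation (d := d) isPreconnected_Ioo (hga ξ)
      (fun i => analyticOnNhd_of_mem_fracAlg (hF i) ξ) (fun i => hN i ξ)
      (fun hzero => by simpa [hd] using hzero t₀ ht₀) fun t _ => h t ξ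

lemma isIntegral_of_mem_fracAlg (hg : g ∈ fracAlg E T) : IsIntegral (fracAlg E T) g :=
  isIntegral_algebraMap (R := fracAlg E T) (x := ⟨g, hg⟩)

lemma isIntegral_of_monic_equation {d : ℕ} (hd : d ≠ 0) {F : Fin d → ℝ → E → ℝ}
    (hF : ∀ i, F i ∈ fracAlg E T)
    (h : ∀ t ∈ Ioo 0 T, ∀ ξ, g t ξ ^ d + ∑ i, F i t ξ * g t ξ ^ (i : ℕ) = 0) :
    IsIntegral (fracAlg E T) g := by
  let q : Polynomial (fracAlg E T) := ∑ i : Fin d, .C ⟨F i, hF i⟩ * .X ^ (i : ℕ)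
  have hq : q.degree < d := Polynomial.degree_sum_fin_lt _
  refine IsIntegral.of_aeval_monic (Polynomial.monic_X_pow_add hq) ?_
    (isIntegral_of_mem_fracAlg (sepAlg_le_fracAlg (mem_sepAlg_of_eq_zero fun t ht ξ => ?_)))
  · rwa [add_comm, Polynomial.natDegree_add_eq_right_of_degree_lt (by simpa using hq),
      Polynomial.natDegree_X_pow]
  · rw [← h t ht ξ]
    simp [q, Finset.sum_apply]

end IntegralElements

section TameAlgebras

/-- An algebra of functions of `(t, ξ)` that contains the fractions, is integral over them, consists
of functions analytic in `t ∈ (0,T)` and is stable under `∂ₜ`. It is the setting in which the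
integrals of `|∂ₜ f| / (|f| + 1)` can be estimated. -/
structure IsTameAlgebra (T : ℝ) (A : Subalgebra ℝ (ℝ → E → ℝ)) : Prop where
  fracAlg_le : fracAlg E T ≤ A
  isIntegral : ∀ f ∈ A, IsIntegral (fracAlg E T) f
  analyticOnNhd : ∀ f ∈ A, ∀ ξ, AnalyticOnNhd ℝ (fun t => f t ξ) (Ioo 0 T)
  dt_mem : ∀ f ∈ A, dt f ∈ A

variable {A : Subalgebra ℝ (ℝ → E → ℝ)} {f g : ℝ → E → ℝ}

theorem isTameAlgebra_adjoin {S : Set (ℝ → E → ℝ)}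
    (hS : ∀ f ∈ S, IsIntegral (fracAlg E T) f)
    (hSa : ∀ f ∈ S, ∀ ξ, AnalyticOnNhd ℝ (fun t => f t ξ) (Ioo 0 T))
    (hSd : ∀ f ∈ S, dt f ∈ Algebra.adjoin ℝ (fracAlg E T ∪ S)) :
    IsTameAlgebra T (Algebra.adjoin ℝ (fracAlg E T ∪ S)) := by
  have hfrac : fracAlg E T ≤ Algebra.adjoin ℝ (fracAlg E T ∪ S) := fun f hf =>
    Algebra.subset_adjoin (Or.inl hf)
  have hsep := sepAlg_le_fracAlg.trans hfrac
  have han : ∀ f ∈ Algebra.adjoin ℝ (fracAlg E T ∪ S), ∀ ξ,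
      AnalyticOnNhd ℝ (fun t => f t ξ) (Ioo 0 T) := fun f hf ξ => by
    induction hf using Algebra.adjoin_induction with
    | mem f hf => exact hf.elim (fun hf => analyticOnNhd_of_mem_fracAlg hf ξ) (hSa f · ξ)
    | algebraMap r => exact analyticOnNhd_const
    | add f g _ _ hf hg => exact hf.add hg
    | mul f g _ _ hf hg => exact hf.mul hg
  refine ⟨hfrac, fun f hf => ?_, han, fun f hf => ?_⟩
  · induction hf using Algebra.adjoin_induction with
    | mem f hf => exact hf.elim isIntegral_of_mem_fracAlg (hS f)
    | algebraMap r => exact isIntegral_of_mem_fracAlg (algebraMap_mem _ r)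
    | add f g _ _ hf hg => exact hf.add hg
    | mul f g _ _ hf hg => exact hf.mul hg
  · induction hf using Algebra.adjoin_induction with
    | mem f hf => exact hf.elim (fun hf => hfrac (dt_mem_fracAlg hf)) (hSd f)
    | algebraMap r => exact hfrac (dt_mem_fracAlg (algebraMap_mem _ r))
    | add f g hfA hgA hf hg =>
      exact mem_congr_of_sepAlg_le hsep (add_mem hf hg) fun t ht ξ => deriv_fun_add
        (han f hfA ξ t ht).differentiableAt (han g hgA ξ t ht).differentiableAt
    | mul f g hfA hgA hf hg =>
      exact mem_congr_of_sepAlg_le hsep (add_mem (mul_mem hf hgA) (mul_mem hfA hg))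
        fun t ht ξ => deriv_fun_mul
          (han f hfA ξ t ht).differentiableAt (han g hgA ξ t ht).differentiableAt

end TameAlgebras

section TotalVariation

variable {f f' : ℝ → ℝ} {K a b : ℝ}

lemma nonneg_or_nonpos_of_ne_zero (hf : ContinuousOn f (Icc a b))
    (h0 : ∀ t ∈ Ioo a b, f t ≠ 0) : (∀ t ∈ Icc a b, 0 ≤ f t) ∨ ∀ t ∈ Icc a b, f t ≤ 0 := by
  by_contra! h
  obtain ⟨⟨x, hx, hfx⟩, y, hy, hfy⟩ := h
  obtain ⟨z, hz, hfz⟩ := intermediate_value_uIcc (hf.mono (uIcc_subset_Icc hx hy))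
    (mem_uIcc.2 (Or.inl ⟨hfx.le, hfy.le⟩))
  have hzI := uIcc_subset_Icc hx hy hz
  have hzx : z ≠ x := fun h => hfx.ne (h ▸ hfz)
  have hzy : z ≠ y := fun h => hfy.ne' (h ▸ hfz)
  refine h0 z ⟨hzI.1.lt_of_ne fun h => ?_, hzI.2.lt_of_ne fun h => ?_⟩ hfz <;>
    grind [mem_uIcc]

lemma integral_abs_deriv_le_of_ne_zero (hab : a ≤ b)
    (hf : ∀ t ∈ Icc a b, HasDerivAt f (f' t) t) (hf' : ContinuousOn f' (Icc a b))
    (hK : ∀ t ∈ Icc a b, |f t| ≤ K) (h0 : ∀ t ∈ Ioo a b, f' t ≠ 0) :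
    ∫ t in a..b, |f' t| ≤ 2 * K := by
  have hIcc : uIcc a b = Icc a b := uIcc_of_le hab
  have hint : ∫ t in a..b, f' t = f b - f a :=
    intervalIntegral.integral_eq_sub_of_hasDerivAt (hIcc ▸ hf) (hf'.intervalIntegrable_of_Icc hab)
  have hfb := abs_le.1 (hK b (right_mem_Icc.2 hab))
  have hfa := abs_le.1 (hK a (left_mem_Icc.2 hab))
  rcases nonneg_or_nonpos_of_ne_zero hf' h0 with hs | hs
  · rw [intervalIntegral.integral_congr fun t ht => abs_of_nonneg (hs t (hIcc ▸ ht)), hint]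
    linarith
  · rw [intervalIntegral.integral_congr fun t ht => abs_of_nonpos (hs t (hIcc ▸ ht)),
      intervalIntegral.integral_neg, hint]
    linarith

lemma card_filter_lt_add_card_filter_gt {Z : Finset ℝ} {z : ℝ} (hz : z ∈ Z) :
    (Z.filter (· < z)).card + (Z.filter (z < ·)).card + 1 = Z.card := by
  have hgt : Z.filter (¬ · < z) = insert z (Z.filter (z < ·)) := by
    ext x
    simp only [Finset.mem_filter, Finset.mem_insert, not_lt, le_iff_eq_or_lt]
    grind
  rw [← Z.card_filter_add_card_filter_not (· < z), hgt, Finset.card_insert_of_notMem (by simp),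
    add_assoc]

lemma integral_abs_deriv_le (hab : a ≤ b)
    (hf : ∀ t ∈ Icc a b, HasDerivAt f (f' t) t) (hf' : ContinuousOn f' (Icc a b))
    (hK : ∀ t ∈ Icc a b, |f t| ≤ K) (Z : Finset ℝ) (hZ : ∀ t ∈ Ioo a b, f' t = 0 → t ∈ Z) :
    ∫ t in a..b, |f' t| ≤ 2 * K * (Z.card + 1) := by
  have hK0 : 0 ≤ K := (abs_nonneg _).trans (hK a (left_mem_Icc.2 hab))
  induction hn : Z.card using Nat.strong_induction_on generalizing Z a b with
  | _ N ih =>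
  subst hn
  by_cases hz : ∃ z ∈ Ioo a b, f' z = 0
  · obtain ⟨z, hz, hz0⟩ := hz
    have hcard := card_filter_lt_add_card_filter_gt (hZ z hz hz0)
    have hl : Icc a z ⊆ Icc a b := Icc_subset_Icc_right hz.2.le
    have hr : Icc z b ⊆ Icc a b := Icc_subset_Icc_left hz.1.le
    have hleft := ih _ (by omega) hz.1.le (fun t ht => hf t (hl ht)) (hf'.mono hl)
      (fun t ht => hK t (hl ht)) (Z.filter (· < z))
      (fun t ht h0 => Finset.mem_filter.2 ⟨hZ t ⟨ht.1, ht.2.trans hz.2⟩ h0, ht.2⟩) rfl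
    have hright := ih _ (by omega) hz.2.le (fun t ht => hf t (hr ht)) (hf'.mono hr)
      (fun t ht => hK t (hr ht)) (Z.filter (z < ·))
      (fun t ht h0 => Finset.mem_filter.2 ⟨hZ t ⟨hz.1.trans ht.1, ht.2⟩ h0, ht.1⟩) rfl
    rw [← intervalIntegral.integral_add_adjacent_intervals (b := z)
      ((hf'.mono hl).abs.intervalIntegrable_of_Icc hz.1.le)
      ((hf'.mono hr).abs.intervalIntegrable_of_Icc hz.2.le), ← hcard]
    push_cast
    linarith
  · push Not at hz
    refine (integral_abs_deriv_le_of_ne_zero hab hf hf' hK hz).trans ?_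
    exact le_mul_of_one_le_right (by positivity) (by simp)

lemma intervalIntegrable_and_integral_abs_le_of_forall_Icc {B : ℝ} (hab : a < b)
    (hf : ContinuousOn f (Ioo a b))
    (h : ∀ x y, a < x → x ≤ y → y < b → ∫ t in x..y, |f t| ≤ B) :
    IntervalIntegrable f volume a b ∧ ∫ t in a..b, |f t| ≤ B := by
  obtain ⟨x, -, hx, hxa⟩ := exists_seq_strictAnti_tendsto' (left_lt_add_div_two.2 hab)
  obtain ⟨y, -, hy, hyb⟩ := exists_seq_strictMono_tendsto' (add_div_two_lt_right.2 hab)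
  have hxy : ∀ k, x k ≤ y k := fun k => (hx k).2.le.trans (hy k).1.le
  have hcover : AECover (volume.restrict (Ioo a b)) atTop fun k => Icc (x k) (y k) :=
    aecover_Ioo_of_Icc hxa hyb
  have hsub : ∀ k, Icc (x k) (y k) ⊆ Ioo a b := fun k =>
    Icc_subset_Ioo (hx k).1 (hy k).2
  have hle : ∀ k, ∫ t in Icc (x k) (y k), ‖f t‖ ∂volume.restrict (Ioo a b) ≤ B := fun k => by
    rw [Measure.restrict_restrict measurableSet_Icc, inter_eq_left.2 (hsub k),
      integral_Icc_eq_integral_Ioc, ← intervalIntegral.integral_of_le (hxy k)]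
    exact h _ _ (hx k).1 (hxy k) (hy k).2
  have hint : IntegrableOn f (Ioo a b) :=
    hcover.integrable_of_integral_norm_bounded B
      (fun k => ((hf.mono (hsub k)).integrableOn_Icc).mono_measure Measure.restrict_le_self)
      (Eventually.of_forall hle)
  refine ⟨(intervalIntegrable_iff_integrableOn_Ioo_of_le hab.le).2 hint, ?_⟩
  rw [intervalIntegral.integral_of_le hab.le, integral_Ioc_eq_integral_Ioo]
  exact le_of_tendsto (hcover.integral_tendsto_of_countably_generated hint.norm)
    (Eventually.of_forall hle)

lemma abs_arsinh_le {x : ℝ} (h : |x| ≤ K) : |Real.arsinh x| ≤ Real.log (1 + 2 * K) := by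
  have hnonneg : ∀ y : ℝ, 0 ≤ y → y ≤ K → Real.arsinh y ≤ Real.log (1 + 2 * K) := by
    intro y hy hyK
    have hsqrt : √(1 + y ^ 2) ≤ 1 + y := Real.sqrt_le_iff.2 ⟨by linarith, by nlinarith⟩
    exact Real.log_le_log (by positivity) (by linarith)
  rcases le_total 0 x with hx | hx
  · rw [abs_of_nonneg (Real.arsinh_nonneg_iff.2 hx)]
    exact hnonneg x hx ((le_abs_self x).trans h)
  · rw [abs_of_nonpos (Real.arsinh_nonpos_iff.2 hx), ← Real.arsinh_neg]
    exact hnonneg (-x) (by linarith) ((neg_le_abs x).trans h)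

/-- `|f'| / (|f| + 1)` is at most the modulus of the derivative of `arsinh ∘ f`, so the integral is
bounded by the total variation of `arsinh ∘ f`. -/
lemma integral_abs_deriv_div_le (hab : a ≤ b)
    (hf : ∀ t ∈ Icc a b, HasDerivAt f (f' t) t) (hf' : ContinuousOn f' (Icc a b))
    (hK : ∀ t ∈ Icc a b, |f t| ≤ K) (Z : Finset ℝ) (hZ : ∀ t ∈ Ioo a b, f' t = 0 → t ∈ Z) :
    ∫ t in a..b, |f' t| / (|f t| + 1) ≤ 2 * Real.log (1 + 2 * K) * (Z.card + 1) := by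
  have hfc : ContinuousOn f (Icc a b) := fun t ht => (hf t ht).continuousAt.continuousWithinAt
  have harsinh : ContinuousOn (fun t => (√(1 + f t ^ 2))⁻¹ * f' t) (Icc a b) :=
    (((continuousOn_const.add (hfc.pow 2)).sqrt).inv₀ fun t _ =>
      (show 0 < √(1 + f t ^ 2) by positivity).ne').mul hf'
  calc ∫ t in a..b, |f' t| / (|f t| + 1)
      ≤ ∫ t in a..b, |(√(1 + f t ^ 2))⁻¹ * f' t| := by
        refine intervalIntegral.integral_mono_on hab (ContinuousOn.intervalIntegrable_of_Icc hab
          (hf'.abs.div (hfc.abs.add continuousOn_const) fun t _ => by positivity))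
          (harsinh.abs.intervalIntegrable_of_Icc hab) fun t _ => ?_
        have hsqrt : √(1 + f t ^ 2) ≤ |f t| + 1 :=
          Real.sqrt_le_iff.2 ⟨by positivity, by nlinarith [sq_abs (f t), abs_nonneg (f t)]⟩
        rw [abs_mul, abs_of_pos (show 0 < (√(1 + f t ^ 2))⁻¹ by positivity), div_eq_inv_mul]
        gcongr
    _ ≤ 2 * Real.log (1 + 2 * K) * (Z.card + 1) :=
        integral_abs_deriv_le hab (fun t ht => (hf t ht).arsinh) harsinh
          (fun t ht => abs_arsinh_le (hK t ht)) Z fun t ht h0 =>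
            hZ t ht ((mul_eq_zero.1 h0).resolve_left (by positivity))

theorem integral_abs_deriv_div_le_of_zeroBound {N : ℕ} (hab : a < b)
    (hf : ∀ t ∈ Ioo a b, HasDerivAt f (f' t) t) (hf' : ContinuousOn f' (Ioo a b))
    (hK : ∀ t ∈ Ioo a b, |f t| ≤ K) (hN : ZeroBound (Ioo a b) N f') :
    IntervalIntegrable (fun t => |f' t| / (|f t| + 1)) volume a b ∧
      ∫ t in a..b, |(|f' t| / (|f t| + 1))| ≤ 2 * Real.log (1 + 2 * K) * (N + 1) := by
  have hfc : ContinuousOn f (Ioo a b) := fun t ht => (hf t ht).continuousAt.continuousWithinAt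
  have hK0 : 0 ≤ K :=
    let ⟨t, ht⟩ := nonempty_Ioo.2 hab
    (abs_nonneg _).trans (hK t ht)
  have hlog : 0 ≤ Real.log (1 + 2 * K) := Real.log_nonneg (by linarith)
  refine intervalIntegrable_and_integral_abs_le_of_forall_Icc hab
    (hf'.abs.div (hfc.abs.add continuousOn_const) fun t _ => by positivity)
    fun x y hx hxy hy => ?_
  have hsub : Icc x y ⊆ Ioo a b := Icc_subset_Ioo hx hy
  have habs : ∀ t, |(|f' t| / (|f t| + 1))| = |f' t| / (|f t| + 1) := fun t =>
    abs_of_nonneg (by positivity)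
  simp only [habs]
  rcases hN with h0 | hN
  · rw [intervalIntegral.integral_congr (g := fun _ => 0) fun t ht => by
      simp [h0 t (hsub (uIcc_of_le hxy ▸ ht))], intervalIntegral.integral_zero]
    positivity
  · have hfin := finite_of_encard_le_coe hN
    have hcard : hfin.toFinset.card ≤ N := by
      exact_mod_cast hfin.encard_eq_coe_toFinset_card ▸ hN
    refine (integral_abs_deriv_div_le hxy (fun t ht => hf t (hsub ht)) (hf'.mono hsub)
      (fun t ht => hK t (hsub ht)) hfin.toFinset fun t ht h0 =>
        hfin.mem_toFinset.2 ⟨hsub (Ioo_subset_Icc_self ht), h0⟩).trans ?_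
    gcongr

end TotalVariation

section LogBounds

variable {E : Type*} [NormedAddCommGroup E] {T : ℝ} {F G : ℝ → E → ℝ}

/-- `∫₀ᵀ |F(t,ξ)| dt ≲ log (2 + |ξ|)`, uniformly for all `ξ`. In contrast to `LogCondition`, the
bound does not degenerate at `ξ = 0`. -/
def LogBdd (T : ℝ) (F : ℝ → E → ℝ) : Prop :=
  ∃ C : ℝ, ∀ ξ, IntervalIntegrable (fun t => F t ξ) volume 0 T ∧
    ∫ t in (0 : ℝ)..T, |F t ξ| ≤ C * Real.log (2 + ‖ξ‖)

lemma LogBdd.mono (hT : 0 < T) (hG : LogBdd T G)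
    (hF : ∀ ξ, ContinuousOn (fun t => F t ξ) (Ioo 0 T))
    (h : ∀ t ∈ Ioo 0 T, ∀ ξ, |F t ξ| ≤ |G t ξ|) : LogBdd T F := by
  obtain ⟨C, hG⟩ := hG
  refine ⟨C, fun ξ => intervalIntegrable_and_integral_abs_le_of_forall_Icc hT (hF ξ)
    fun x y hx hxy hy => ?_⟩
  have hsub : Icc x y ⊆ Ioo 0 T := Icc_subset_Ioo hx hy
  have hGint : IntervalIntegrable (fun t => |G t ξ|) volume 0 T := (hG ξ).1.abs
  calc ∫ t in x..y, |F t ξ| ≤ ∫ t in x..y, |G t ξ| :=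
        intervalIntegral.integral_mono_on hxy
          (((hF ξ).mono hsub).abs.intervalIntegrable_of_Icc hxy)
          (hGint.mono_set (by
            rw [uIcc_of_le hxy, uIcc_of_le hT.le]
            exact hsub.trans Ioo_subset_Icc_self)) fun t ht => h t (hsub ht) ξ
    _ ≤ ∫ t in (0 : ℝ)..T, |G t ξ| :=
        intervalIntegral.integral_mono_interval hx.le hxy hy.le
          (Eventually.of_forall fun t => abs_nonneg _) hGint
    _ ≤ C * Real.log (2 + ‖ξ‖) := (hG ξ).2

lemma LogBdd.add (hT : 0 ≤ T) (hF : LogBdd T F) (hG : LogBdd T G) : LogBdd T (F + G) := by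
  obtain ⟨C, hF⟩ := hF
  obtain ⟨D, hG⟩ := hG
  refine ⟨C + D, fun ξ => ⟨(hF ξ).1.add (hG ξ).1, ?_⟩⟩
  calc ∫ t in (0 : ℝ)..T, |F t ξ + G t ξ| ≤ ∫ t in (0 : ℝ)..T, (|F t ξ| + |G t ξ|) :=
        intervalIntegral.integral_mono_on hT ((hF ξ).1.add (hG ξ).1).abs
          ((hF ξ).1.abs.add (hG ξ).1.abs) fun t _ => abs_add_le _ _
    _ = (∫ t in (0 : ℝ)..T, |F t ξ|) + ∫ t in (0 : ℝ)..T, |G t ξ| :=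
        intervalIntegral.integral_add (hF ξ).1.abs (hG ξ).1.abs
    _ ≤ (C + D) * Real.log (2 + ‖ξ‖) := by
        rw [add_mul]
        exact add_le_add (hF ξ).2 (hG ξ).2

lemma LogBdd.const_mul (hF : LogBdd T F) (c : ℝ) : LogBdd T fun t ξ => c * F t ξ := by
  obtain ⟨C, hF⟩ := hF
  refine ⟨|c| * C, fun ξ => ⟨(hF ξ).1.const_mul c, ?_⟩⟩
  simp only [abs_mul, intervalIntegral.integral_const_mul, mul_assoc]
  exact mul_le_mul_of_nonneg_left (hF ξ).2 (abs_nonneg c)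

lemma exists_log_one_add_le {C : ℝ} (hC : 0 ≤ C) (m : ℕ) :
    ∃ D, 0 ≤ D ∧ ∀ r, 0 ≤ r → Real.log (1 + C * (1 + r) ^ m) ≤ D * Real.log (2 + r) := by
  obtain ⟨k, hk⟩ := pow_unbounded_of_one_lt (1 + C) one_lt_two
  refine ⟨(k + m : ℕ), by positivity, fun r hr => ?_⟩
  rw [← Real.log_pow]
  refine Real.log_le_log (by positivity) ?_
  calc 1 + C * (1 + r) ^ m ≤ (1 + C) * (1 + r) ^ m := by
        linarith [one_le_pow₀ (n := m) (show 1 ≤ 1 + r by linarith)]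
    _ ≤ (2 + r) ^ k * (2 + r) ^ m := by
        gcongr
        · exact hk.le.trans (by gcongr; linarith)
        · exact one_le_two
    _ = (2 + r) ^ (k + m) := (pow_add _ _ _).symm

variable {A : Subalgebra ℝ (ℝ → E → ℝ)} {f : ℝ → E → ℝ}

theorem IsTameAlgebra.logBdd (hA : IsTameAlgebra T A) (hT : 0 < T) (hf : f ∈ A) :
    LogBdd T fun t ξ => |dt f t ξ| / (|f t ξ| + 1) := by
  obtain ⟨C, m, hC, hCm⟩ := polyBddOn_of_isIntegral (hA.isIntegral f hf)
  obtain ⟨N, hN⟩ := exists_zeroBound_of_isIntegral (hA.isIntegral _ (hA.dt_mem f hf))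
    (hA.analyticOnNhd _ (hA.dt_mem f hf))
  obtain ⟨D, _, hDm⟩ := exists_log_one_add_le (show 0 ≤ 2 * C by positivity) m
  refine ⟨2 * D * (N + 1), fun ξ => ?_⟩
  refine (integral_abs_deriv_div_le_of_zeroBound hT (f := fun t => f t ξ)
    (fun t ht => (hA.analyticOnNhd f hf ξ t ht).differentiableAt.hasDerivAt)
    (hA.analyticOnNhd _ (hA.dt_mem f hf) ξ).continuousOn (fun t ht => hCm t ht ξ)
    (hN ξ)).imp_right fun hle => hle.trans ?_
  have hlog := hDm ‖ξ‖ (norm_nonneg ξ)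
  rw [mul_assoc] at hlog
  calc 2 * Real.log (1 + 2 * (C * (1 + ‖ξ‖) ^ m)) * (N + 1)
      ≤ 2 * (D * Real.log (2 + ‖ξ‖)) * (N + 1) := by gcongr
    _ = 2 * D * (N + 1) * Real.log (2 + ‖ξ‖) := by ring

end LogBounds

section ComplexValued

variable {E : Type*} {A : Subalgebra ℝ (ℝ → E → ℝ)} {f : ℝ → E → ℝ}

/-- The complex-valued functions whose real and imaginary parts belong to `A`. -/
def complexify (A : Subalgebra ℝ (ℝ → E → ℝ)) : Subalgebra ℝ (ℝ → E → ℂ) where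
  carrier := {h | (fun t ξ => (h t ξ).re) ∈ A ∧ (fun t ξ => (h t ξ).im) ∈ A}
  add_mem' hf hg := ⟨add_mem hf.1 hg.1, add_mem hf.2 hg.2⟩
  mul_mem' hf hg := ⟨sub_mem (mul_mem hf.1 hg.1) (mul_mem hf.2 hg.2),
    add_mem (mul_mem hf.1 hg.2) (mul_mem hf.2 hg.1)⟩
  algebraMap_mem' r := ⟨algebraMap_mem A r, zero_mem A⟩

lemma ofReal_mem_complexify (hf : f ∈ A) : (fun t ξ => (f t ξ : ℂ)) ∈ complexify A :=
  ⟨by simpa only [Complex.ofReal_re] using hf, zero_mem A⟩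

variable [NormedAddCommGroup E] {T : ℝ} {h : ℝ → E → ℂ}

lemma mem_complexify_congr (hA : sepAlg E T ≤ A) (hh : h ∈ complexify A) {g : ℝ → E → ℂ}
    (hgh : ∀ t ∈ Ioo 0 T, ∀ ξ, g t ξ = h t ξ) : g ∈ complexify A :=
  ⟨mem_congr_of_sepAlg_le hA hh.1 fun t ht ξ => congrArg Complex.re (hgh t ht ξ),
    mem_congr_of_sepAlg_le hA hh.2 fun t ht ξ => congrArg Complex.im (hgh t ht ξ)⟩

lemma IsTameAlgebra.hasDerivAt_of_mem_complexify (hA : IsTameAlgebra T A)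
    (hh : h ∈ complexify A) {t : ℝ} (ht : t ∈ Ioo 0 T) (ξ : E) :
    HasDerivAt (fun s => h s ξ) (dt (fun t ξ => (h t ξ).re) t ξ
      + dt (fun t ξ => (h t ξ).im) t ξ * Complex.I) t := by
  have hre := (hA.analyticOnNhd _ hh.1 ξ t ht).differentiableAt.hasDerivAt
  have him := (hA.analyticOnNhd _ hh.2 ξ t ht).differentiableAt.hasDerivAt
  simpa only [dt, Complex.re_add_im] using
    hre.ofReal_comp.fun_add (him.ofReal_comp.mul_const Complex.I)

lemma IsTameAlgebra.dt_mem_complexify (hA : IsTameAlgebra T A) (hh : h ∈ complexify A) :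
    dt h ∈ complexify A := by
  have hsep := sepAlg_le_fracAlg.trans hA.fracAlg_le
  refine ⟨mem_congr_of_sepAlg_le hsep (hA.dt_mem _ hh.1) fun t ht ξ => ?_,
    mem_congr_of_sepAlg_le hsep (hA.dt_mem _ hh.2) fun t ht ξ => ?_⟩ <;>
    simp [dt, (hA.hasDerivAt_of_mem_complexify hh ht ξ).deriv]

theorem IsTameAlgebra.logBdd_of_mem_complexify (hA : IsTameAlgebra T A) (hT : 0 < T)
    (hh : h ∈ complexify A) : LogBdd T fun t ξ => ‖dt h t ξ‖ / (‖h t ξ‖ + 1) := by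
  have hcont : ∀ {g : ℝ → E → ℂ}, g ∈ complexify A → ∀ ξ,
      ContinuousOn (fun t => g t ξ) (Ioo 0 T) := fun hg ξ t ht =>
    (hA.hasDerivAt_of_mem_complexify hg ht ξ).continuousAt.continuousWithinAt
  refine ((hA.logBdd hT hh.1).add hT.le (hA.logBdd hT hh.2)).mono hT
    (fun ξ => (hcont (hA.dt_mem_complexify hh) ξ).norm.div
      ((hcont hh ξ).norm.add continuousOn_const) fun t _ => by positivity) fun t ht ξ => ?_
  have hdt : ‖dt h t ξ‖ ≤
      |dt (fun t ξ => (h t ξ).re) t ξ| + |dt (fun t ξ => (h t ξ).im) t ξ| := by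
    rw [dt, (hA.hasDerivAt_of_mem_complexify hh ht ξ).deriv]
    exact (norm_add_le _ _).trans (by simp)
  rw [Pi.add_apply, Pi.add_apply, abs_of_nonneg (by positivity), abs_of_nonneg (by positivity)]
  refine (div_le_div_of_nonneg_right hdt (by positivity)).trans ?_
  rw [add_div]
  gcongr
  · exact Complex.abs_re_le_norm _
  · exact Complex.abs_im_le_norm _

end ComplexValued

section LogConditions

variable {n : ℕ} {T : ℝ} {F : ℝ → EuclideanSpace ℝ (Fin n) → ℝ}

lemma LogBdd.logCondition_of_le (hF : LogBdd T F) {R : ℝ} (hR : 0 < R) :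
    LogCondition T {ξ | R ≤ ‖ξ‖} F := by
  obtain ⟨C, hF⟩ := hF
  have hlogR : 0 < Real.log (1 + R) := Real.log_pos (by linarith)
  refine ⟨fun ξ _ => (hF ξ).1, (|C| + 1) * (Real.log 2 / Real.log (1 + R) + 1), by positivity,
    fun ξ (hξ : R ≤ ‖ξ‖) => ?_⟩
  have hlog : Real.log (1 + R) ≤ Real.log (1 + ‖ξ‖) := Real.log_le_log (by linarith) (by linarith)
  have hlog2 : Real.log 2 ≤ Real.log 2 / Real.log (1 + R) * Real.log (1 + ‖ξ‖) := by
    rw [div_mul_eq_mul_div, le_div_iff₀ hlogR]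
    exact mul_le_mul_of_nonneg_left hlog (Real.log_nonneg one_le_two)
  calc ∫ t in (0 : ℝ)..T, |F t ξ| ≤ C * Real.log (2 + ‖ξ‖) := (hF ξ).2
    _ ≤ (|C| + 1) * (Real.log 2 + Real.log (1 + ‖ξ‖)) := by
        rw [← Real.log_mul two_ne_zero (by positivity)]
        gcongr
        · exact Real.log_nonneg (by linarith [norm_nonneg ξ])
        · exact (le_abs_self C).trans (lt_add_one _).le
        · linarith [norm_nonneg ξ]
    _ ≤ _ := by
        rw [mul_assoc]
        gcongr
        linarith

lemma half_le_log_one_add {r : ℝ} (h0 : 0 ≤ r) (h1 : r ≤ 1) : r / 2 ≤ Real.log (1 + r) := by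
  refine le_trans ?_ (Real.one_sub_inv_le_log_of_pos (show 0 < 1 + r by linarith))
  have hdiff : 1 - (1 + r)⁻¹ - r / 2 = r * (1 - r) / (2 * (1 + r)) := by
    field_simp
    ring
  have hnn : 0 ≤ r * (1 - r) / (2 * (1 + r)) :=
    div_nonneg (mul_nonneg h0 (by linarith)) (by linarith)
  linarith

lemma LogBdd.logCondition_univ (hT : 0 < T) (hF : LogBdd T F)
    {h : ℝ → EuclideanSpace ℝ (Fin n) → ℝ} (hh : PolyBddOn (Ioo 0 T) h)
    (hFh : ∀ t ∈ Ioo 0 T, ∀ ξ, |F t ξ| ≤ ‖ξ‖ * |h t ξ|) : LogCondition T univ F := by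
  obtain ⟨-, C, hC, hle⟩ := hF.logCondition_of_le one_pos
  obtain ⟨_, hF⟩ := hF
  obtain ⟨D, m, hD, hh⟩ := hh
  refine ⟨fun ξ _ => (hF ξ).1, C + 2 * (T * (D * 2 ^ m)), by positivity, fun ξ _ => ?_⟩
  have hlog : 0 ≤ Real.log (1 + ‖ξ‖) := Real.log_nonneg (by linarith [norm_nonneg ξ])
  rcases le_total 1 ‖ξ‖ with hξ | hξ
  · refine (hle ξ hξ).trans (mul_le_mul_of_nonneg_right ?_ hlog)
    exact le_add_of_nonneg_right (by positivity)
  · have hbound : ∀ t ∈ Ioo 0 T, |F t ξ| ≤ ‖ξ‖ * (D * 2 ^ m) := fun t ht =>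
      (hFh t ht ξ).trans (mul_le_mul_of_nonneg_left ((hh t ht ξ).trans (by
        gcongr
        linarith)) (norm_nonneg ξ))
    calc ∫ t in (0 : ℝ)..T, |F t ξ| ≤ ∫ _ in (0 : ℝ)..T, ‖ξ‖ * (D * 2 ^ m) :=
          intervalIntegral.integral_mono_on_of_le_Ioo hT.le (hF ξ).1.abs
            intervalIntegrable_const hbound
      _ = 2 * (T * (D * 2 ^ m)) * (‖ξ‖ / 2) := by
          rw [intervalIntegral.integral_const, smul_eq_mul]
          ring
      _ ≤ (C + 2 * (T * (D * 2 ^ m))) * Real.log (1 + ‖ξ‖) := by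
          gcongr
          · exact le_add_of_nonneg_left hC.le
          · exact half_le_log_one_add (norm_nonneg ξ) hξ

end LogConditions

section DistinctRoots

lemma hasDerivAt_prod_sub {𝕜 ι : Type*} [NontriviallyNormedField 𝕜] [Fintype ι] [DecidableEq ι]
    (x : ι → 𝕜) (j : ι) :
    HasDerivAt (fun z => ∏ i, (z - x i)) (∏ i ∈ Finset.univ.erase j, (x j - x i)) (x j) := by
  have hder := HasDerivAt.fun_finsetProd (u := Finset.univ) (f := fun i z => z - x i)
    fun i _ => (hasDerivAt_id (x j)).sub_const (x i)
  rwa [Finset.sum_eq_single_of_mem j (Finset.mem_univ j) fun i _ hij => by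
    rw [Finset.prod_eq_zero (Finset.mem_erase.2 ⟨hij.symm, Finset.mem_univ j⟩) (sub_self _),
      zero_smul], smul_eq_mul, mul_one] at hder

open scoped ContDiff in
lemma exists_analyticAt_implicitFunction {f : ℝ × ℝ → ℝ} {t₀ x₀ c : ℝ}
    (hf : AnalyticAt ℝ f (t₀, x₀)) (h₀ : f (t₀, x₀) = 0)
    (hc : HasDerivAt (fun z => f (t₀, z)) c x₀) (hc₀ : c ≠ 0) :
    ∃ r : ℝ → ℝ, AnalyticAt ℝ r t₀ ∧ r t₀ = x₀ ∧ ∀ᶠ t in 𝓝 t₀, f (t, r t) = 0 := by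
  have hfω : ContDiffAt ℝ ω f (t₀, x₀) := hf.contDiffAt
  have hpartial : (fderiv ℝ f (t₀, x₀) ∘L .inr ℝ ℝ ℝ) 1 = c := by
    have hline : HasDerivAt (fun s : ℝ => (t₀, s)) (0, 1) x₀ :=
      (hasDerivAt_const x₀ t₀).prodMk (hasDerivAt_id x₀)
    simpa using
      (hf.differentiableAt.hasFDerivAt.comp_hasDerivAt x₀ hline).unique hc
  have hinv : (fderiv ℝ f (t₀, x₀) ∘L .inr ℝ ℝ ℝ).IsInvertible :=
    ⟨ContinuousLinearEquiv.unitsEquivAut ℝ (Units.mk0 c hc₀), by ext; simp [hpartial]⟩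
  refine ⟨hfω.implicitFunction (by simp) hinv,
    (hfω.contDiffAt_implicitFunction (by simp) hinv).analyticAt,
    hfω.implicitFunction_apply_self (by simp) hinv, ?_⟩
  filter_upwards [hfω.eventually_apply_implicitFunction (by simp) hinv] with t ht
  exact ht.trans h₀

variable {d : ℕ} {F x : Fin d → ℝ → ℝ} {s : Set ℝ} {t : ℝ}

lemma exists_analyticAt_root_of_strictMono (hF : ∀ i, AnalyticAt ℝ (F i) t)
    (hx : StrictMono fun j => x j t)
    (h : ∀ z, ∏ j, (z - x j t) = z ^ d + ∑ i, F i t * z ^ (i : ℕ)) (j : Fin d) :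
    ∃ r : ℝ → ℝ, AnalyticAt ℝ r t ∧ r t = x j t ∧
      ∀ᶠ s in 𝓝 t, r s ^ d + ∑ i, F i s * r s ^ (i : ℕ) = 0 := by
  refine exists_analyticAt_implicitFunction
    (f := fun v => v.2 ^ d + ∑ i, F i v.1 * v.2 ^ (i : ℕ))
    (c := ∏ i ∈ Finset.univ.erase j, (x j t - x i t)) ?_ ?_ ?_ ?_
  · exact (analyticAt_snd.pow d).add (Finset.analyticAt_fun_sum _ fun i _ =>
      ((hF i).comp_of_eq analyticAt_fst rfl).mul (analyticAt_snd.pow i))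
  · exact (h (x j t)).symm.trans (Finset.prod_eq_zero (Finset.mem_univ j) (sub_self _))
  · simpa only [h] using hasDerivAt_prod_sub (fun i => x i t) j
  · exact Finset.prod_ne_zero_iff.2 fun i hi =>
      sub_ne_zero.2 (hx.injective.ne (Finset.ne_of_mem_erase hi).symm)

theorem analyticOn_root_of_strictMono (hF : ∀ i, AnalyticOnNhd ℝ (F i) s)
    (hx : ∀ t ∈ s, StrictMono fun j => x j t)
    (h : ∀ t ∈ s, ∀ z, ∏ j, (z - x j t) = z ^ d + ∑ i, F i t * z ^ (i : ℕ)) (j : Fin d) :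
    AnalyticOn ℝ (x j) s := by
  intro t ht
  choose r hr hrt hroot using
    exists_analyticAt_root_of_strictMono (fun i => hF i t ht) (hx t ht) (h t ht)
  have hlt : ∀ᶠ s in 𝓝 t, ∀ i k, i < k → r i s < r k s :=
    eventually_all.2 fun i => eventually_all.2 fun k => eventually_imp_distrib_left.2 fun hik =>
      (hr i).continuousAt.eventually_lt (hr k).continuousAt (by
        rw [hrt, hrt]
        exact hx t ht hik)
  have heq : ∀ᶠ u in 𝓝 t, u ∈ s → x j u = r j u := by
    filter_upwards [hlt, eventually_all.2 hroot] with u hu hu₀ hus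
    have hmem : ∀ i, ∃ k, r i u = x k u := fun i => by
      have hprod := (h u hus (r i u)).trans (hu₀ i)
      obtain ⟨k, -, hk⟩ := Finset.prod_eq_zero_iff.1 hprod
      exact ⟨k, sub_eq_zero.1 hk⟩
    choose σ hσ using hmem
    have hσmono : StrictMono σ := fun i k hik =>
      (hx u hus).lt_iff_lt.1 (by simpa only [← hσ] using hu i k hik)
    rw [hσ, hσmono.eq_id, id]
  exact (hr j).analyticWithinAt.congr_of_eventuallyEq (eventually_nhdsWithin_iff.2 heq)
    (heq.self_of_nhds ht)

end DistinctRoots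

section RootFamilies

variable {E : Type*} [NormedAddCommGroup E] {T : ℝ}

lemma norm_mem_sepAlg : (fun _ ξ => ‖ξ‖) ∈ sepAlg E T := by
  simpa only [one_mul] using mem_sepAlg_of_analyticOnNhd (E := E) (T := T) (b := fun _ => 1)
    (p := norm) analyticOnNhd_const ⟨1, 1, zero_le_one, fun _ _ ξ => by simp⟩

variable (E T) in
/-- The functions that are analytic in `t ∈ [0,T]`, belong to `sepAlg E T` and have a `t`-derivative
with a factor `‖ξ‖`: these are the coefficients of the polynomials in `IsRootFamily`. -/
def coeffModule : Submodule ℝ (ℝ → E → ℝ) where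
  carrier := {F | (∀ ξ, AnalyticOnNhd ℝ (fun t => F t ξ) (Icc 0 T)) ∧ F ∈ sepAlg E T ∧
    ∃ G ∈ sepAlg E T, ∀ t ∈ Ioo 0 T, ∀ ξ, dt F t ξ = ‖ξ‖ * G t ξ}
  zero_mem' := ⟨fun _ => analyticOnNhd_const, zero_mem _, 0, zero_mem _, by simp [dt]⟩
  add_mem' := by
    rintro F F' ⟨han, hF, G, hG, h⟩ ⟨han', hF', G', hG', h'⟩
    refine ⟨fun ξ => (han ξ).add (han' ξ), add_mem hF hF', G + G', add_mem hG hG',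
      fun t ht ξ => ?_⟩
    rw [Pi.add_apply, Pi.add_apply, mul_add, ← h t ht, ← h' t ht]
    exact deriv_fun_add (han ξ t (Ioo_subset_Icc_self ht)).differentiableAt
      (han' ξ t (Ioo_subset_Icc_self ht)).differentiableAt
  smul_mem' := by
    rintro c F ⟨han, hF, G, hG, h⟩
    refine ⟨fun ξ => analyticOnNhd_const.mul (han ξ), Subalgebra.smul_mem _ hF c, c • G,
      Subalgebra.smul_mem _ hG c, fun t ht ξ => ?_⟩
    rw [Pi.smul_apply, Pi.smul_apply, smul_eq_mul, mul_left_comm, ← h t ht]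
    exact deriv_const_mul c (han ξ t (Ioo_subset_Icc_self ht)).differentiableAt

lemma const_mem_coeffModule (c : ℝ) : (fun _ _ => c) ∈ coeffModule E T :=
  ⟨fun _ => analyticOnNhd_const, algebraMap_mem _ c, 0, zero_mem _, by simp [dt]⟩

lemma mul_mem_coeffModule {b : ℝ → ℝ} (hb : AnalyticOnNhd ℝ b (Icc 0 T)) {p q : E → ℝ}
    (hq : PolyBddOn univ fun _ => q) (hpq : ∀ ξ, p ξ = ‖ξ‖ * q ξ) :
    (fun t ξ => b t * p ξ) ∈ coeffModule E T := by
  have hmem : ∀ {c : ℝ → ℝ}, AnalyticOnNhd ℝ c (Icc 0 T) → (fun t ξ => c t * q ξ) ∈ sepAlg E T :=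
    fun hc => mem_sepAlg_of_analyticOnNhd hc hq
  refine ⟨fun ξ => hb.mul analyticOnNhd_const, ?_, _, hmem hb.deriv, fun t ht ξ => ?_⟩
  · convert mul_mem norm_mem_sepAlg (hmem hb) using 3 with t ξ
    simp only [Pi.mul_apply, hpq]
    ring
  · rw [dt, deriv_mul_const (hb t (Ioo_subset_Icc_self ht)).differentiableAt, hpq]
    ring

/-- `∏_{j ≠ k} (xⱼ - xₖ)`, which is up to sign the discriminant of `∏ⱼ (X - xⱼ)`. -/
def prodDiff {R : Type*} [CommRing R] {d : ℕ} (x : Fin d → R) : R :=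
  ∏ j, ∏ k ∈ Finset.univ.erase j, (x j - x k)

/-- For `t ∈ [0,T]`, the numbers `x 0 t ξ < x 1 t ξ < …` are the roots of the monic polynomial of
degree `d` with the coefficients `F i t ξ`, and the discriminant of this polynomial is bounded away
from zero. -/
structure IsRootFamily {d : ℕ} (T : ℝ) (F x : Fin d → ℝ → E → ℝ) : Prop where
  coeff_mem : ∀ i, F i ∈ coeffModule E T
  strictMono : ∀ t ∈ Icc 0 T, ∀ ξ, StrictMono fun j => x j t ξ
  prod_eq : ∀ t ∈ Icc 0 T, ∀ ξ z, ∏ j, (z - x j t ξ) = z ^ d + ∑ i, F i t ξ * z ^ (i : ℕ)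
  prodDiff_mem : prodDiff x ∈ sepAlg E T
  exists_le_abs_prodDiff : ∃ c > 0, ∀ t ∈ Ioo 0 T, ∀ ξ, c ≤ |prodDiff x t ξ|

/-- The algebra generated by `fracAlg E T` and the functions `xⱼ`. -/
def rootAlg {d : ℕ} (T : ℝ) (x : Fin d → ℝ → E → ℝ) : Subalgebra ℝ (ℝ → E → ℝ) :=
  Algebra.adjoin ℝ (fracAlg E T ∪ range x)

variable {d : ℕ} {F x : Fin d → ℝ → E → ℝ}

lemma fracAlg_le_rootAlg : fracAlg E T ≤ rootAlg T x :=
  fun _ hf => Algebra.subset_adjoin (Or.inl hf)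

lemma mem_rootAlg (j : Fin d) : x j ∈ rootAlg T x :=
  Algebra.subset_adjoin (Or.inr (mem_range_self j))

theorem IsRootFamily.analyticOn (hx : IsRootFamily T F x) (j : Fin d) (ξ : E) :
    AnalyticOn ℝ (fun t => x j t ξ) (Icc 0 T) :=
  analyticOn_root_of_strictMono (F := fun i t => F i t ξ) (x := fun j t => x j t ξ)
    (fun i => (hx.coeff_mem i).1 ξ) (fun t ht => hx.strictMono t ht ξ)
    (fun t ht => hx.prod_eq t ht ξ) j

lemma IsRootFamily.analyticOnNhd (hx : IsRootFamily T F x) (j : Fin d) (ξ : E) :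
    AnalyticOnNhd ℝ (fun t => x j t ξ) (Ioo 0 T) :=
  isOpen_Ioo.analyticOn_iff_analyticOnNhd.1 ((hx.analyticOn j ξ).mono Ioo_subset_Icc_self)

lemma IsRootFamily.root_equation (hx : IsRootFamily T F x) (j : Fin d) {t : ℝ}
    (ht : t ∈ Icc 0 T) (ξ : E) :
    x j t ξ ^ d + ∑ i, F i t ξ * x j t ξ ^ (i : ℕ) = 0 :=
  (hx.prod_eq t ht ξ _).symm.trans (Finset.prod_eq_zero (Finset.mem_univ j) (sub_self _))

/-- Differentiate `∏ₖ (z - xₖ) = z ^ d + ∑ᵢ Fᵢ z ^ i` in `t` at fixed `z` and put `z = xⱼ`. -/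
lemma IsRootFamily.dt_mul_prod_sub (hx : IsRootFamily T F x) (j : Fin d) {t : ℝ}
    (ht : t ∈ Ioo 0 T) (ξ : E) :
    dt (x j) t ξ * ∏ k ∈ Finset.univ.erase j, (x j t ξ - x k t ξ) =
      -∑ i, dt (F i) t ξ * x j t ξ ^ (i : ℕ) := by
  set z := x j t ξ with hz
  have hprod : HasDerivAt (fun s => ∏ k, (z - x k s ξ))
      (∑ k, (∏ i ∈ Finset.univ.erase k, (z - x i t ξ)) • -dt (x k) t ξ) t :=
    HasDerivAt.fun_finsetProd fun k _ =>
      (hx.analyticOnNhd k ξ t ht).differentiableAt.hasDerivAt.const_sub z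
  have hsum : HasDerivAt (fun s => z ^ d + ∑ i, F i s ξ * z ^ (i : ℕ))
      (∑ i, dt (F i) t ξ * z ^ (i : ℕ)) t :=
    (HasDerivAt.fun_sum fun i _ => (((hx.coeff_mem i).1 ξ t
      (Ioo_subset_Icc_self ht)).differentiableAt.hasDerivAt.mul_const _)).const_add _
  have heq : (fun s => ∏ k, (z - x k s ξ)) =ᶠ[𝓝 t] fun s => z ^ d + ∑ i, F i s ξ * z ^ (i : ℕ) :=
    mem_of_superset (isOpen_Ioo.mem_nhds ht) fun s hs => hx.prod_eq s (Ioo_subset_Icc_self hs) ξ z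
  have hderiv := hprod.unique (hsum.congr_of_eventuallyEq heq)
  rw [Finset.sum_eq_single_of_mem j (Finset.mem_univ j) fun k _ hkj => by
    rw [Finset.prod_eq_zero (Finset.mem_erase.2 ⟨hkj.symm, Finset.mem_univ j⟩)
      (sub_eq_zero.2 hz), zero_smul], smul_eq_mul] at hderiv
  linear_combination -hderiv

lemma IsRootFamily.inv_prodDiff_mem (hx : IsRootFamily T F x) :
    (prodDiff x)⁻¹ ∈ fracAlg E T := by
  obtain ⟨c, hc, hle⟩ := hx.exists_le_abs_prodDiff
  have hinv := inv_mem_fracAlg (pow_mem hx.prodDiff_mem 2) (pow_pos hc 2) fun t ht ξ => by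
    simpa using pow_le_pow_left₀ hc.le (hle t ht ξ) 2
  convert mul_mem hinv (sepAlg_le_fracAlg hx.prodDiff_mem) using 1
  funext t ξ
  simp only [Pi.mul_apply, Pi.inv_apply, Pi.pow_apply]
  rcases eq_or_ne (prodDiff x t ξ) 0 with h0 | h0
  · simp [h0]
  · field_simp

lemma IsRootFamily.exists_dt_eq (hx : IsRootFamily T F x) (j : Fin d) :
    ∃ y ∈ rootAlg T x, ∀ t ∈ Ioo 0 T, ∀ ξ, dt (x j) t ξ = ‖ξ‖ * y t ξ := by
  choose G hG hFG using fun i => (hx.coeff_mem i).2.2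
  refine ⟨-((prodDiff x)⁻¹ * (∏ i ∈ Finset.univ.erase j, ∏ k ∈ Finset.univ.erase i, (x i - x k)) *
    ∑ i, G i * x j ^ (i : ℕ)), neg_mem (mul_mem (mul_mem ?_ ?_) ?_), fun t ht ξ => ?_⟩
  · exact fracAlg_le_rootAlg hx.inv_prodDiff_mem
  · exact prod_mem fun i _ => prod_mem fun k _ => sub_mem (mem_rootAlg i) (mem_rootAlg k)
  · exact sum_mem fun i _ =>
      mul_mem (fracAlg_le_rootAlg (sepAlg_le_fracAlg (hG i))) (pow_mem (mem_rootAlg j) _)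
  · obtain ⟨c, hc, hle⟩ := hx.exists_le_abs_prodDiff
    have hD : prodDiff x t ξ ≠ 0 := abs_pos.1 (hc.trans_le (hle t ht ξ))
    have hsplit := congrFun (congrFun (Finset.mul_prod_erase Finset.univ
      (fun i => ∏ k ∈ Finset.univ.erase i, (x i - x k)) (Finset.mem_univ j)) t) ξ
    have hdt := hx.dt_mul_prod_sub j ht ξ
    simp only [hFG _ t ht, mul_assoc, ← Finset.mul_sum] at hdt
    change _ = prodDiff x t ξ at hsplit
    simp only [Pi.mul_apply, Pi.neg_apply, Pi.inv_apply, Finset.prod_apply, Finset.sum_apply,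
      Pi.sub_apply, Pi.pow_apply] at hsplit ⊢
    field_simp
    linear_combination (-dt (x j) t ξ) * hsplit +
      (∏ i ∈ Finset.univ.erase j, ∏ k ∈ Finset.univ.erase i, (x i t ξ - x k t ξ)) * hdt

theorem IsRootFamily.isTameAlgebra (hx : IsRootFamily T F x) :
    IsTameAlgebra T (rootAlg T x) := by
  refine isTameAlgebra_adjoin ?_ ?_ ?_ <;> rintro _ ⟨j, rfl⟩
  · exact isIntegral_of_monic_equation j.pos.ne'
      (fun i => sepAlg_le_fracAlg (hx.coeff_mem i).2.1)
      fun t ht ξ => hx.root_equation j (Ioo_subset_Icc_self ht) ξ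
  · exact hx.analyticOnNhd j
  · obtain ⟨y, hy, hdt⟩ := hx.exists_dt_eq j
    exact mem_congr_of_sepAlg_le (sepAlg_le_fracAlg.trans fracAlg_le_rootAlg)
      (mul_mem (fracAlg_le_rootAlg (sepAlg_le_fracAlg norm_mem_sepAlg)) hy) hdt

end RootFamilies

section RootLogConditions

variable {n : ℕ} {T : ℝ} {S : Set (EuclideanSpace ℝ (Fin n))}

lemma LogCondition.congr {F G : ℝ → EuclideanSpace ℝ (Fin n) → ℝ} (hT : 0 ≤ T)
    (hF : LogCondition T S F) (h : ∀ t ∈ Ioo 0 T, ∀ ξ ∈ S, F t ξ = G t ξ) :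
    LogCondition T S G := by
  obtain ⟨hFint, C, hC, hle⟩ := hF
  have heq : ∀ ξ ∈ S, EqOn (fun t => F t ξ) (fun t => G t ξ) (Ioo 0 T) :=
    fun ξ hξ t ht => h t ht ξ hξ
  refine ⟨fun ξ hξ => (hFint ξ hξ).congr_uIoo (uIoo_of_le hT ▸ heq ξ hξ), C, hC, fun ξ hξ => ?_⟩
  have hint : ∫ t in (0 : ℝ)..T, |F t ξ| = ∫ t in (0 : ℝ)..T, |G t ξ| :=
    intervalIntegral.integral_congr_Ioo_of_le hT ((heq ξ hξ).comp_left (g := abs))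
  exact hint ▸ hle ξ hξ

lemma LogCondition.add {F G : ℝ → EuclideanSpace ℝ (Fin n) → ℝ} (hT : 0 ≤ T)
    (hF : LogCondition T S F) (hG : LogCondition T S G) : LogCondition T S (F + G) := by
  obtain ⟨hFint, C, hC, hF⟩ := hF
  obtain ⟨hGint, D, hD, hG⟩ := hG
  refine ⟨fun ξ hξ => (hFint ξ hξ).add (hGint ξ hξ), C + D, by positivity, fun ξ hξ => ?_⟩
  calc ∫ t in (0 : ℝ)..T, |F t ξ + G t ξ| ≤ ∫ t in (0 : ℝ)..T, (|F t ξ| + |G t ξ|) :=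
        intervalIntegral.integral_mono_on hT ((hFint ξ hξ).add (hGint ξ hξ)).abs
          ((hFint ξ hξ).abs.add (hGint ξ hξ).abs) fun t _ => abs_add_le _ _
    _ = (∫ t in (0 : ℝ)..T, |F t ξ|) + ∫ t in (0 : ℝ)..T, |G t ξ| :=
        intervalIntegral.integral_add (hFint ξ hξ).abs (hGint ξ hξ).abs
    _ ≤ (C + D) * Real.log (1 + ‖ξ‖) := by
        rw [add_mul]
        exact add_le_add (hF ξ hξ) (hG ξ hξ)

lemma LogCondition.sum (hT : 0 ≤ T) {ι : Type*} (I : Finset ι)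
    {F : ι → ℝ → EuclideanSpace ℝ (Fin n) → ℝ} (hF : ∀ i ∈ I, LogCondition T S (F i)) :
    LogCondition T S fun t ξ => ∑ i ∈ I, F i t ξ := by
  simp only [← Finset.sum_apply]
  refine Finset.sum_induction F (LogCondition T S) (fun _ _ => LogCondition.add hT)
    ⟨fun _ _ => by simp, 1, one_pos, fun ξ _ => ?_⟩ hF
  simpa using Real.log_nonneg (le_add_of_nonneg_right (norm_nonneg ξ))

variable {A : Subalgebra ℝ (ℝ → EuclideanSpace ℝ (Fin n) → ℝ)}
  {f g h : ℝ → EuclideanSpace ℝ (Fin n) → ℝ}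

theorem IsTameAlgebra.logCondition_univ (hA : IsTameAlgebra T A) (hT : 0 < T) (hf : f ∈ A)
    (hh : h ∈ A) (hfh : ∀ t ∈ Ioo 0 T, ∀ ξ, dt f t ξ = ‖ξ‖ * h t ξ) :
    LogCondition T univ fun t ξ => |dt f t ξ| / (|f t ξ| + 1) := by
  refine (hA.logBdd hT hf).logCondition_univ hT (polyBddOn_of_isIntegral (hA.isIntegral h hh))
    fun t ht ξ => ?_
  rw [abs_of_nonneg (by positivity), hfh t ht, abs_mul, abs_norm]
  exact div_le_self (by positivity) (by simp)

theorem IsTameAlgebra.logCondition_univ_logDeriv (hA : IsTameAlgebra T A) (hT : 0 < T)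
    (hf : f ∈ A) (hf1 : ∀ t ∈ Ioo 0 T, ∀ ξ, 1 ≤ |f t ξ|) (hh : h ∈ A)
    (hfh : ∀ t ∈ Ioo 0 T, ∀ ξ, dt f t ξ = ‖ξ‖ * h t ξ) :
    LogCondition T univ fun t ξ => |dt f t ξ| / |f t ξ| := by
  have hlog : LogBdd T fun t ξ => |dt f t ξ| / |f t ξ| := by
    refine ((hA.logBdd hT hf).const_mul 2).mono hT (fun ξ => ?_) fun t ht ξ => ?_
    · exact (hA.analyticOnNhd _ (hA.dt_mem f hf) ξ).continuousOn.abs.div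
        (hA.analyticOnNhd f hf ξ).continuousOn.abs
        fun t ht => (one_pos.trans_le (hf1 t ht ξ)).ne'
    · have hpos := one_pos.trans_le (hf1 t ht ξ)
      calc |(|dt f t ξ| / |f t ξ|)| = 2 * (|dt f t ξ| / (2 * |f t ξ|)) := by
            rw [abs_of_nonneg (by positivity)]
            field_simp
        _ ≤ 2 * (|dt f t ξ| / (|f t ξ| + 1)) := by
            gcongr
            linarith [hf1 t ht ξ]
        _ ≤ _ := le_abs_self _
  refine hlog.logCondition_univ hT (polyBddOn_of_isIntegral (hA.isIntegral h hh))
    fun t ht ξ => ?_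
  rw [abs_of_nonneg (by positivity), hfh t ht, abs_mul, abs_norm]
  exact div_le_self (by positivity) (hf1 t ht ξ)

lemma IsTameAlgebra.dt_sub (hA : IsTameAlgebra T A) (hf : f ∈ A) (hg : g ∈ A) :
    ∀ t ∈ Ioo 0 T, ∀ ξ, dt (f - g) t ξ = dt f t ξ - dt g t ξ := fun t ht ξ =>
  deriv_fun_sub (hA.analyticOnNhd f hf ξ t ht).differentiableAt
    (hA.analyticOnNhd g hg ξ t ht).differentiableAt

lemma IsTameAlgebra.dt_dt_sub (hA : IsTameAlgebra T A) (hf : f ∈ A) (hg : g ∈ A) :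
    ∀ t ∈ Ioo 0 T, ∀ ξ, dt (dt (f - g)) t ξ = dt (dt f) t ξ - dt (dt g) t ξ := fun t ht ξ =>
  (dt_congr (hA.dt_sub hf hg) t ht ξ).trans
    (hA.dt_sub (hA.dt_mem f hf) (hA.dt_mem g hg) t ht ξ)

variable {d : ℕ} {F x : Fin d → ℝ → EuclideanSpace ℝ (Fin n) → ℝ}

lemma IsRootFamily.exists_dt_sub_eq (hx : IsRootFamily T F x) (j k : Fin d) :
    ∃ y ∈ rootAlg T x, ∀ t ∈ Ioo 0 T, ∀ ξ, dt (x j - x k) t ξ = ‖ξ‖ * y t ξ := by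
  obtain ⟨y, hy, hdt⟩ := hx.exists_dt_eq j
  obtain ⟨y', hy', hdt'⟩ := hx.exists_dt_eq k
  refine ⟨y - y', sub_mem hy hy', fun t ht ξ => ?_⟩
  rw [hx.isTameAlgebra.dt_sub (mem_rootAlg j) (mem_rootAlg k) t ht, hdt t ht, hdt' t ht, ← mul_sub]
  rfl

theorem IsRootFamily.logCondition_logDeriv_sub (hx : IsRootFamily T F x) (hT : 0 < T) {j k : Fin d}
    (hjk : ∀ t ∈ Ioo 0 T, ∀ ξ, 1 ≤ |x j t ξ - x k t ξ|) :
    LogCondition T univ fun t ξ => |dt (x j) t ξ - dt (x k) t ξ| / |x j t ξ - x k t ξ| := by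
  have hA := hx.isTameAlgebra
  obtain ⟨y, hy, hdt⟩ := hx.exists_dt_sub_eq j k
  refine (hA.logCondition_univ_logDeriv hT (sub_mem (mem_rootAlg j) (mem_rootAlg k)) hjk hy
    hdt).congr hT.le fun t ht ξ _ => ?_
  rw [hA.dt_sub (mem_rootAlg j) (mem_rootAlg k) t ht]
  rfl

theorem IsRootFamily.logCondition_dt_dt_sub (hx : IsRootFamily T F x) (hT : 0 < T) (j k : Fin d) :
    LogCondition T univ fun t ξ => |dt (dt (x j)) t ξ - dt (dt (x k)) t ξ| /
      (|dt (x j) t ξ - dt (x k) t ξ| + 1) := by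
  have hA := hx.isTameAlgebra
  obtain ⟨y, hy, hdt⟩ := hx.exists_dt_sub_eq j k
  have hdtdt : ∀ t ∈ Ioo 0 T, ∀ ξ, dt (dt (x j - x k)) t ξ = ‖ξ‖ * dt y t ξ := fun t ht ξ =>
    (dt_congr hdt t ht ξ).trans (deriv_const_mul_field _)
  refine (hA.logCondition_univ hT (hA.dt_mem _ (sub_mem (mem_rootAlg j) (mem_rootAlg k)))
    (hA.dt_mem y hy) hdtdt).congr hT.le fun t ht ξ _ => ?_
  rw [hA.dt_sub (mem_rootAlg j) (mem_rootAlg k) t ht,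
    hA.dt_dt_sub (mem_rootAlg j) (mem_rootAlg k) t ht]

end RootLogConditions

section OrderedRoots

open Polynomial

variable {p : ℂ[X]} {d : ℕ}

lemma length_sort_roots (hd : p.natDegree = d) :
    ((p.roots.map Complex.re).sort (· ≤ ·)).length = d := by
  rw [Multiset.length_sort, Multiset.card_map, ← hd]
  exact splits_iff_card_roots.1 (IsAlgClosed.splits p)

lemma eq_prod_orderedRoot (hd : p.natDegree = d) (hr : ∀ z, p.eval z = 0 → z.im = 0) :
    p = C p.leadingCoeff * ∏ j : Fin d, (X - C (orderedRoot p j : ℂ)) := by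
  rcases eq_or_ne p 0 with rfl | hp
  · simp
  have hlen := length_sort_roots hd
  set l := (p.roots.map Complex.re).sort (· ≤ ·) with hl
  subst hlen
  have hroots : ((l.map ((↑) : ℝ → ℂ) : List ℂ) : Multiset ℂ) = p.roots := by
    rw [← Multiset.map_coe, hl, Multiset.sort_eq, Multiset.map_map]
    conv_rhs => rw [← Multiset.map_id p.roots]
    refine Multiset.map_congr rfl fun z hz => ?_
    exact Complex.ext (by simp) (by simp [hr z ((mem_roots hp).1 hz)])
  have hprod : ∏ j : Fin l.length, (X - C (orderedRoot p j : ℂ)) =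
      (p.roots.map fun z => X - C z).prod := by
    rw [← hroots, Multiset.map_coe, Multiset.prod_coe, List.map_map, ← List.prod_ofFn]
    congr 1
    refine List.ext_getElem (by simp) fun i hi _ => ?_
    simp [orderedRoot, ← hl]
  rw [hprod]
  exact (C_leadingCoeff_mul_prod_multiset_X_sub_C
    (splits_iff_card_roots.1 (IsAlgClosed.splits p))).symm

lemma orderedRoot_le (hd : p.natDegree = d) {i j : ℕ} (hij : i ≤ j) (hj : j < d) :
    orderedRoot p i ≤ orderedRoot p j := by
  have hlen := length_sort_roots hd
  rcases hij.eq_or_lt with rfl | hlt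
  · rfl
  rw [orderedRoot, orderedRoot, List.getD_eq_getElem _ _ (by omega),
    List.getD_eq_getElem _ _ (by omega)]
  exact List.pairwise_iff_getElem.1 (Multiset.pairwise_sort _ _) i j _ _ hlt

end OrderedRoots

section RealCubics

lemma im_eq_zero_of_quadratic {b c d : ℝ} {z : ℂ} (hb : b ≠ 0) (hdisc : 0 ≤ discrim b c d)
    (hz : b * (z * z) + c * z + d = 0) : z.im = 0 := by
  have hsqrt : discrim (b : ℂ) c d = (√(discrim b c d) : ℂ) * √(discrim b c d) := by
    rw [← Complex.ofReal_mul, Real.mul_self_sqrt hdisc]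
    simp [discrim]
  rcases (quadratic_eq_zero_iff (Complex.ofReal_ne_zero.2 hb) hsqrt z).1 hz with rfl | rfl
  · exact_mod_cast Complex.ofReal_im ((-c + √(discrim b c d)) / (2 * b))
  · exact_mod_cast Complex.ofReal_im ((-c - √(discrim b c d)) / (2 * b))

lemma im_eq_zero_of_depressed_cubic {p q : ℝ} {z : ℂ} (hpq : 27 * q ^ 2 < 4 * p ^ 3)
    (hz : z ^ 3 - p * z - q = 0) : z.im = 0 := by
  by_contra hy
  have hp : 0 < p := by
    by_contra! hp
    nlinarith [sq_nonneg q, pow_nonneg (neg_nonneg.2 hp) 3]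
  have hre := congrArg Complex.re hz
  have him := congrArg Complex.im hz
  simp only [pow_succ, pow_zero, one_mul, Complex.sub_re, Complex.sub_im, Complex.mul_re,
    Complex.mul_im, Complex.ofReal_re, Complex.ofReal_im, Complex.zero_re, Complex.zero_im]
    at hre him
  set u := z.re
  set y := z.im
  have hy2 : y ^ 2 = 3 * u ^ 2 - p := mul_left_cancel₀ hy (by linear_combination -him)
  have hq : q = 2 * u * (p - 4 * u ^ 2) := by linear_combination -hre - 3 * u * hy2
  have hu : p / 3 ≤ u ^ 2 := by linarith [sq_nonneg y]
  have hq2 : 4 * (p / 3 * (p / 3) ^ 2) ≤ q ^ 2 := by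
    calc 4 * (p / 3 * (p / 3) ^ 2) ≤ 4 * (u ^ 2 * (4 * u ^ 2 - p) ^ 2) := by
          gcongr
          linarith
      _ = q ^ 2 := by
          rw [hq]
          ring
  linarith

lemma depressed_coeffs_of_real_roots {u v w : ℝ} (h : u + v + w = 0) :
    0 ≤ -(u * v + u * w + v * w) ∧
      27 * (u * v * w) ^ 2 ≤ 4 * (-(u * v + u * w + v * w)) ^ 3 := by
  obtain rfl : w = -u - v := by linarith
  constructor
  · nlinarith [sq_nonneg (u + v), sq_nonneg u, sq_nonneg v]
  · nlinarith [sq_nonneg ((u - v) * (2 * u + v) * (u + 2 * v))]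

/-- For `L = u³ - p u - q` one has `L - L'' = u³ - (p + 6) u - q`. -/
lemma le_discr_of_depressed {p q : ℝ} (hp : 0 ≤ p) (hq : 27 * q ^ 2 ≤ 4 * p ^ 3) :
    24 * (p + 6) ^ 2 ≤ 4 * (p + 6) ^ 3 - 27 * q ^ 2 := by
  nlinarith [sq_nonneg p]

lemma im_eq_zero_of_cubic_sub_deriv_deriv {l₀ l₁ l₂ : ℝ} {z : ℂ}
    (hz : (z - l₀) * (z - l₁) * (z - l₂) - (6 * z - 2 * (l₀ + l₁ + l₂)) = 0) : z.im = 0 := by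
  obtain ⟨s, hs⟩ : ∃ s, l₀ + l₁ + l₂ = 3 * s := ⟨(l₀ + l₁ + l₂) / 3, by ring⟩
  obtain ⟨hp, hq⟩ :=
    depressed_coeffs_of_real_roots (show l₀ - s + (l₁ - s) + (l₂ - s) = 0 by linarith)
  have hdisc := le_discr_of_depressed hp hq
  have hs' : (l₀ + l₁ + l₂ : ℂ) = 3 * s := by exact_mod_cast hs
  set p := -((l₀ - s) * (l₁ - s) + (l₀ - s) * (l₂ - s) + (l₁ - s) * (l₂ - s)) with hp_def
  set q := (l₀ - s) * (l₁ - s) * (l₂ - s) with hq_def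
  have him : (z - s).im = 0 := by
    refine im_eq_zero_of_depressed_cubic (p := p + 6) (q := q) ?_ ?_
    · have hpos : 0 < (p + 6) ^ 2 := by positivity
      linarith
    · rw [hp_def, hq_def]
      push_cast
      linear_combination hz + (z ^ 2 - 2 * z * s + s ^ 2 - 2) * hs'
  rwa [Complex.sub_im, Complex.ofReal_im, sub_zero] at him

/-- By AM-GM, `B * D ≤ ((B + D) / 2) ^ 2 ≤ 9 * P ^ 2`. -/
lemma le_of_sum_eq_of_le_prod {A B D P : ℝ} (hA : 0 ≤ A) (hB : 0 ≤ B) (hD : 0 ≤ D) (hP : 0 < P)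
    (hsum : A + B + D = 6 * P) (hprod : 24 * P ^ 2 ≤ A * B * D) : 8 / 3 ≤ A := by
  have hBD : B * D ≤ 9 * P ^ 2 := by nlinarith [sq_nonneg (B - D)]
  refine le_of_mul_le_mul_right ?_ (show 0 < 9 * P ^ 2 by positivity)
  linarith [mul_le_mul_of_nonneg_left hBD hA]

lemma depressed_gap_bounds {p q u v w : ℝ} (hp : 0 ≤ p) (hq : 27 * q ^ 2 ≤ 4 * p ^ 3)
    (hadd : u + v + w = 0) (hpair : u * v + u * w + v * w = -(p + 6)) (hmul : u * v * w = q) :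
    8 / 3 ≤ (u - v) ^ 2 ∧ 8 / 3 ≤ (v - w) ^ 2 ∧ 8 / 3 ≤ (w - u) ^ 2 ∧
      864 ≤ (u - v) ^ 2 * (v - w) ^ 2 * (w - u) ^ 2 := by
  have hsum : (u - v) ^ 2 + (v - w) ^ 2 + (w - u) ^ 2 = 6 * (p + 6) := by
    linear_combination 2 * (u + v + w) * hadd - 6 * hpair
  have hprod : (u - v) ^ 2 * (v - w) ^ 2 * (w - u) ^ 2 = 4 * (p + 6) ^ 3 - 27 * q ^ 2 := by
    obtain rfl : w = -u - v := by linarith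
    rw [← hmul, show p + 6 = u ^ 2 + u * v + v ^ 2 by linarith]
    ring
  have hge : 24 * (p + 6) ^ 2 ≤ (u - v) ^ 2 * (v - w) ^ 2 * (w - u) ^ 2 :=
    (le_discr_of_depressed hp hq).trans_eq hprod.symm
  have hpos : 0 < p + 6 := by linarith
  exact ⟨le_of_sum_eq_of_le_prod (sq_nonneg _) (sq_nonneg _) (sq_nonneg _) hpos hsum hge,
    le_of_sum_eq_of_le_prod (sq_nonneg _) (sq_nonneg (w - u)) (sq_nonneg (u - v)) hpos
      (by linarith) (hge.trans_eq (by ring)),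
    le_of_sum_eq_of_le_prod (sq_nonneg _) (sq_nonneg (u - v)) (sq_nonneg (v - w)) hpos
      (by linarith) (hge.trans_eq (by ring)),
    (show 864 ≤ 24 * (p + 6) ^ 2 by nlinarith).trans hge⟩

/-- The hypotheses say that `x₀, x₁, x₂` are the roots of `L - L''`, where `L` is the monic cubic
with the roots `l₀, l₁, l₂`. -/
lemma gap_bounds_of_cubic_sub_deriv_deriv {l₀ l₁ l₂ x₀ x₁ x₂ : ℝ}
    (hadd : x₀ + x₁ + x₂ = l₀ + l₁ + l₂)
    (hpair : x₀ * x₁ + x₀ * x₂ + x₁ * x₂ = l₀ * l₁ + l₀ * l₂ + l₁ * l₂ - 6)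
    (hmul : x₀ * x₁ * x₂ = l₀ * l₁ * l₂ - 2 * (l₀ + l₁ + l₂)) :
    8 / 3 ≤ (x₀ - x₁) ^ 2 ∧ 8 / 3 ≤ (x₁ - x₂) ^ 2 ∧ 8 / 3 ≤ (x₂ - x₀) ^ 2 ∧
      864 ≤ (x₀ - x₁) ^ 2 * (x₁ - x₂) ^ 2 * (x₂ - x₀) ^ 2 := by
  obtain ⟨s, hs⟩ : ∃ s, l₀ + l₁ + l₂ = 3 * s := ⟨(l₀ + l₁ + l₂) / 3, by ring⟩
  obtain ⟨hp, hq⟩ :=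
    depressed_coeffs_of_real_roots (show l₀ - s + (l₁ - s) + (l₂ - s) = 0 by linarith)
  have hbounds := depressed_gap_bounds (u := x₀ - s) (v := x₁ - s) (w := x₂ - s) hp hq
    (by linarith) (by linear_combination hpair - 2 * s * hadd)
    (by linear_combination hmul - s * hpair + s ^ 2 * hadd - 2 * hs)
  simpa only [sub_sub_sub_cancel_right] using hbounds

end RealCubics

section Symbols

open Polynomial

variable {n : ℕ}

lemma symL_eq (a : Coeffs n) (t : ℝ) (ξ : EuclideanSpace ℝ (Fin n)) :
    symL a t ξ = X ^ 3 + C (coeffSum a 2 1 t ξ) * X ^ 2 + C (coeffSum a 1 2 t ξ) * X +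
      C (coeffSum a 0 3 t ξ) := by
  simp only [symL, Finset.sum_range_succ, Finset.range_zero, Finset.sum_empty, Nat.sub_zero,
    Nat.reduceSub, pow_zero, pow_one]
  ring

lemma derivative_symL_eq (a : Coeffs n) (t : ℝ) (ξ : EuclideanSpace ℝ (Fin n)) :
    derivative (symL a t ξ) =
      3 * X ^ 2 + 2 * C (coeffSum a 2 1 t ξ) * X + C (coeffSum a 1 2 t ξ) := by
  simp only [symL_eq, derivative_add, derivative_X_pow, derivative_C_mul, derivative_C,
    derivative_X, Nat.reduceSub, pow_one, Nat.cast_ofNat, C_ofNat]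
  ring

lemma derivative_derivative_symL_eq (a : Coeffs n) (t : ℝ) (ξ : EuclideanSpace ℝ (Fin n)) :
    derivative (derivative (symL a t ξ)) = 6 * X + 2 * C (coeffSum a 2 1 t ξ) := by
  simp only [derivative_symL_eq, derivative_add, derivative_mul, derivative_X_pow, derivative_C,
    derivative_X, derivative_ofNat, Nat.reduceSub, pow_one, Nat.cast_ofNat, C_ofNat]
  ring

lemma auxL_eq (a : Coeffs n) (t : ℝ) (ξ : EuclideanSpace ℝ (Fin n)) :
    auxL a t ξ = X ^ 3 + C (coeffSum a 2 1 t ξ) * X ^ 2 + C (coeffSum a 1 2 t ξ - 6) * X +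
      C (coeffSum a 0 3 t ξ - 2 * coeffSum a 2 1 t ξ) := by
  rw [auxL, derivative_derivative_symL_eq, symL_eq]
  simp only [C_sub, C_mul, C_ofNat]
  ring

lemma derivative_auxL_eq (a : Coeffs n) (t : ℝ) (ξ : EuclideanSpace ℝ (Fin n)) :
    derivative (auxL a t ξ) = C 3 * X ^ 2 + C (2 * coeffSum a 2 1 t ξ) * X +
      C (coeffSum a 1 2 t ξ - 6) := by
  rw [auxL, derivative_derivative_symL_eq, derivative_sub, derivative_symL_eq]
  simp only [derivative_add, derivative_mul, derivative_C, derivative_X, derivative_ofNat, C_sub,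
    C_mul, C_ofNat]
  ring

lemma monic_cubic (b c d : ℂ) : (X ^ 3 + C b * X ^ 2 + C c * X + C d : ℂ[X]).Monic := by
  monicity!

lemma natDegree_cubic (b c d : ℂ) :
    (X ^ 3 + C b * X ^ 2 + C c * X + C d : ℂ[X]).natDegree = 3 := by
  compute_degree!

lemma natDegree_auxL (a : Coeffs n) (t : ℝ) (ξ : EuclideanSpace ℝ (Fin n)) :
    (auxL a t ξ).natDegree = 3 := by
  rw [auxL_eq, natDegree_cubic]

lemma natDegree_derivative_auxL (a : Coeffs n) (t : ℝ) (ξ : EuclideanSpace ℝ (Fin n)) :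
    (derivative (auxL a t ξ)).natDegree = 2 := by
  rw [derivative_auxL_eq]
  compute_degree!

lemma vieta_cubic {b c d x y z : ℂ}
    (h : (X ^ 3 + C b * X ^ 2 + C c * X + C d : ℂ[X]) = (X - C x) * (X - C y) * (X - C z)) :
    b = -(x + y + z) ∧ c = x * y + x * z + y * z ∧ d = -(x * y * z) := by
  have h0 := congrArg (eval 0) h
  have h1 := congrArg (eval 1) h
  have h2 := congrArg (eval (-1)) h
  simp only [eval_add, eval_mul, eval_pow, eval_X, eval_C, eval_sub] at h0 h1 h2
  refine ⟨?_, ?_, ?_⟩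
  · linear_combination (h1 + h2) / 2 - h0
  · linear_combination (h1 - h2) / 2
  · linear_combination h0

/-- The real part of the coefficient of `τ ^ j` in `L(t,τ,ξ)`; this coefficient is real where the
operator is weakly hyperbolic. -/
def symCoeff (a : Coeffs n) (j : ℕ) (t : ℝ) (ξ : EuclideanSpace ℝ (Fin n)) : ℝ :=
  (coeffSum a j (3 - j) t ξ).re

variable {a : Coeffs n} {T t : ℝ}

lemma exists_roots_symL (hL : WeaklyHyperbolic a T) (ht : t ∈ Icc 0 T)
    (ξ : EuclideanSpace ℝ (Fin n)) :
    ∃ l₀ l₁ l₂ : ℝ, coeffSum a 2 1 t ξ = -(l₀ + l₁ + l₂) ∧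
      coeffSum a 1 2 t ξ = l₀ * l₁ + l₀ * l₂ + l₁ * l₂ ∧ coeffSum a 0 3 t ξ = -(l₀ * l₁ * l₂) := by
  have hprod := eq_prod_orderedRoot (by rw [symL_eq, natDegree_cubic]) (hL t ht ξ)
  rw [Fin.prod_univ_three, symL_eq, (monic_cubic _ _ _).leadingCoeff, C_1, one_mul] at hprod
  exact ⟨_, _, _, vieta_cubic hprod⟩

lemma coeffSum_eq_ofReal_symCoeff (hL : WeaklyHyperbolic a T) (ht : t ∈ Icc 0 T)
    (ξ : EuclideanSpace ℝ (Fin n)) :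
    coeffSum a 2 1 t ξ = symCoeff a 2 t ξ ∧ coeffSum a 1 2 t ξ = symCoeff a 1 t ξ ∧
      coeffSum a 0 3 t ξ = symCoeff a 0 t ξ := by
  obtain ⟨l₀, l₁, l₂, h₂, h₁, h₀⟩ := exists_roots_symL hL ht ξ
  simp only [symCoeff, Nat.sub_zero, Nat.reduceSub, h₂, h₁, h₀]
  norm_cast

lemma exists_roots_symCoeff (hL : WeaklyHyperbolic a T) (ht : t ∈ Icc 0 T)
    (ξ : EuclideanSpace ℝ (Fin n)) :
    ∃ l₀ l₁ l₂ : ℝ, symCoeff a 2 t ξ = -(l₀ + l₁ + l₂) ∧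
      symCoeff a 1 t ξ = l₀ * l₁ + l₀ * l₂ + l₁ * l₂ ∧ symCoeff a 0 t ξ = -(l₀ * l₁ * l₂) := by
  obtain ⟨l₀, l₁, l₂, hl⟩ := exists_roots_symL hL ht ξ
  obtain ⟨h₂, h₁, h₀⟩ := coeffSum_eq_ofReal_symCoeff hL ht ξ
  rw [h₂, h₁, h₀] at hl
  exact ⟨l₀, l₁, l₂, by exact_mod_cast hl⟩

lemma eval_auxL_im_eq_zero (hL : WeaklyHyperbolic a T) (ht : t ∈ Icc 0 T)
    (ξ : EuclideanSpace ℝ (Fin n)) (z : ℂ) (hz : (auxL a t ξ).eval z = 0) : z.im = 0 := by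
  obtain ⟨l₀, l₁, l₂, h₂, h₁, h₀⟩ := exists_roots_symL hL ht ξ
  simp only [auxL_eq, h₂, h₁, h₀, eval_add, eval_mul, eval_pow, eval_X, eval_C] at hz
  exact im_eq_zero_of_cubic_sub_deriv_deriv (l₀ := l₀) (l₁ := l₁) (l₂ := l₂)
    (by linear_combination hz)

lemma auxL_eq_prod (hL : WeaklyHyperbolic a T) (ht : t ∈ Icc 0 T)
    (ξ : EuclideanSpace ℝ (Fin n)) : auxL a t ξ = ∏ j : Fin 3, (X - C (lam a j t ξ : ℂ)) := by
  have hmonic : (auxL a t ξ).Monic := by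
    rw [auxL_eq]
    exact monic_cubic _ _ _
  have hprod := eq_prod_orderedRoot (natDegree_auxL a t ξ) (eval_auxL_im_eq_zero hL ht ξ)
  rwa [hmonic.leadingCoeff, C_1, one_mul] at hprod

lemma lam_vieta (hL : WeaklyHyperbolic a T) (ht : t ∈ Icc 0 T) (ξ : EuclideanSpace ℝ (Fin n)) :
    symCoeff a 2 t ξ = -(lam a 0 t ξ + lam a 1 t ξ + lam a 2 t ξ) ∧
    symCoeff a 1 t ξ - 6 = lam a 0 t ξ * lam a 1 t ξ + lam a 0 t ξ * lam a 2 t ξ +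
      lam a 1 t ξ * lam a 2 t ξ ∧
    symCoeff a 0 t ξ - 2 * symCoeff a 2 t ξ = -(lam a 0 t ξ * lam a 1 t ξ * lam a 2 t ξ) := by
  have hprod := auxL_eq_prod hL ht ξ
  obtain ⟨h₂, h₁, h₀⟩ := coeffSum_eq_ofReal_symCoeff hL ht ξ
  rw [Fin.prod_univ_three, auxL_eq, h₂, h₁, h₀] at hprod
  exact_mod_cast vieta_cubic hprod

lemma lam_gaps (hL : WeaklyHyperbolic a T) (ht : t ∈ Icc 0 T) (ξ : EuclideanSpace ℝ (Fin n)) :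
    8 / 3 ≤ (lam a 0 t ξ - lam a 1 t ξ) ^ 2 ∧ 8 / 3 ≤ (lam a 1 t ξ - lam a 2 t ξ) ^ 2 ∧
    8 / 3 ≤ (lam a 2 t ξ - lam a 0 t ξ) ^ 2 ∧
    864 ≤ (lam a 0 t ξ - lam a 1 t ξ) ^ 2 * (lam a 1 t ξ - lam a 2 t ξ) ^ 2 *
      (lam a 2 t ξ - lam a 0 t ξ) ^ 2 := by
  obtain ⟨h₂, h₁, h₀⟩ := lam_vieta hL ht ξ
  obtain ⟨l₀, l₁, l₂, hl₂, hl₁, hl₀⟩ := exists_roots_symCoeff hL ht ξ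
  exact gap_bounds_of_cubic_sub_deriv_deriv (l₀ := l₀) (l₁ := l₁) (l₂ := l₂) (by linarith)
    (by linarith) (by linarith)

lemma one_le_abs_lam_sub (hL : WeaklyHyperbolic a T) (ht : t ∈ Icc 0 T)
    (ξ : EuclideanSpace ℝ (Fin n)) {p : Fin 3 × Fin 3} (hp : p ∈ S2) :
    1 ≤ |lam a p.1 t ξ - lam a p.2 t ξ| := by
  obtain ⟨h₀₁, h₁₂, h₂₀, -⟩ := lam_gaps hL ht ξ
  refine (one_le_sq_iff_one_le_abs _).1 ?_
  simp only [S2, Finset.mem_insert, Finset.mem_singleton] at hp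
  rcases hp with rfl | rfl | rfl <;> linarith

lemma lam_strictMono (hL : WeaklyHyperbolic a T) (ht : t ∈ Icc 0 T)
    (ξ : EuclideanSpace ℝ (Fin n)) : StrictMono fun j => lam a j t ξ := by
  refine Fin.strictMono_iff_lt_succ.2 fun j => lt_of_le_of_ne
    (orderedRoot_le (natDegree_auxL a t ξ) (by simp) j.succ.2) (sub_ne_zero.1 (abs_pos.1 ?_))
  refine one_pos.trans_le (one_le_abs_lam_sub hL ht ξ (p := (j.castSucc, j.succ)) ?_)
  fin_cases j <;> decide

lemma symCoeff_discrim_ge (hL : WeaklyHyperbolic a T) (ht : t ∈ Icc 0 T)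
    (ξ : EuclideanSpace ℝ (Fin n)) :
    18 ≤ symCoeff a 2 t ξ ^ 2 - 3 * (symCoeff a 1 t ξ - 6) := by
  obtain ⟨l₀, l₁, l₂, hl₂, hl₁, -⟩ := exists_roots_symCoeff hL ht ξ
  rw [hl₂, hl₁]
  linarith [sq_nonneg (l₀ - l₁), sq_nonneg (l₀ - l₂), sq_nonneg (l₁ - l₂)]

lemma eval_derivative_auxL_im_eq_zero (hL : WeaklyHyperbolic a T) (ht : t ∈ Icc 0 T)
    (ξ : EuclideanSpace ℝ (Fin n)) (z : ℂ) (hz : (derivative (auxL a t ξ)).eval z = 0) :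
    z.im = 0 := by
  obtain ⟨h₂, h₁, -⟩ := coeffSum_eq_ofReal_symCoeff hL ht ξ
  simp only [derivative_auxL_eq, h₂, h₁, eval_add, eval_mul, eval_pow, eval_X, eval_C] at hz
  refine im_eq_zero_of_quadratic (b := 3) (c := 2 * symCoeff a 2 t ξ) (d := symCoeff a 1 t ξ - 6)
    three_ne_zero ?_ ?_
  · rw [discrim]
    linarith [symCoeff_discrim_ge hL ht ξ]
  · push_cast
    linear_combination hz

lemma derivative_auxL_eq_prod (hL : WeaklyHyperbolic a T) (ht : t ∈ Icc 0 T)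
    (ξ : EuclideanSpace ℝ (Fin n)) :
    derivative (auxL a t ξ) = C 3 * ∏ j : Fin 2, (X - C (mu a j t ξ : ℂ)) := by
  have hprod := eq_prod_orderedRoot (natDegree_derivative_auxL a t ξ)
    (eval_derivative_auxL_im_eq_zero hL ht ξ)
  have hlead : (derivative (auxL a t ξ)).leadingCoeff = 3 := by
    rw [derivative_auxL_eq, leadingCoeff_quadratic three_ne_zero]
  rwa [hlead] at hprod

lemma mu_vieta (hL : WeaklyHyperbolic a T) (ht : t ∈ Icc 0 T) (ξ : EuclideanSpace ℝ (Fin n)) :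
    2 * symCoeff a 2 t ξ = -(3 * (mu a 0 t ξ + mu a 1 t ξ)) ∧
      symCoeff a 1 t ξ - 6 = 3 * (mu a 0 t ξ * mu a 1 t ξ) := by
  have hprod := derivative_auxL_eq_prod hL ht ξ
  obtain ⟨h₂, h₁, -⟩ := coeffSum_eq_ofReal_symCoeff hL ht ξ
  rw [Fin.prod_univ_two, derivative_auxL_eq, h₂, h₁] at hprod
  have heval0 := congrArg (eval 0) hprod
  have heval1 := congrArg (eval 1) hprod
  simp only [eval_add, eval_mul, eval_pow, eval_X, eval_C, eval_sub] at heval0 heval1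
  refine ⟨?_, ?_⟩ <;> rw [← Complex.ofReal_inj] <;> push_cast
  · linear_combination heval1 - heval0
  · linear_combination heval0

lemma mu_sub_sq (hL : WeaklyHyperbolic a T) (ht : t ∈ Icc 0 T) (ξ : EuclideanSpace ℝ (Fin n)) :
    (mu a 0 t ξ - mu a 1 t ξ) ^ 2 =
      4 / 9 * (symCoeff a 2 t ξ ^ 2 - 3 * (symCoeff a 1 t ξ - 6)) := by
  obtain ⟨hadd, hmul⟩ := mu_vieta hL ht ξ
  linear_combination 4 / 3 * hmul +
    (mu a 0 t ξ + mu a 1 t ξ - 2 / 3 * symCoeff a 2 t ξ) / 3 * hadd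

lemma mu_strictMono (hL : WeaklyHyperbolic a T) (ht : t ∈ Icc 0 T)
    (ξ : EuclideanSpace ℝ (Fin n)) : StrictMono fun j => mu a j t ξ := by
  refine Fin.strictMono_iff_lt_succ.2 fun j => ?_
  fin_cases j
  refine lt_of_le_of_ne (orderedRoot_le (natDegree_derivative_auxL a t ξ) (by simp) (by simp))
    fun (heq : mu a 0 t ξ = mu a 1 t ξ) => ?_
  have hgap := mu_sub_sq hL ht ξ
  rw [heq, sub_self] at hgap
  linarith [symCoeff_discrim_ge hL ht ξ]

end Symbols

section Coefficients

variable {n : ℕ} {a : Coeffs n} {T : ℝ} {j k : ℕ}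

lemma abs_monomial_le (α : Fin n → ℕ) (ξ : EuclideanSpace ℝ (Fin n)) :
    |∏ i, ξ i ^ α i| ≤ ‖ξ‖ ^ ∑ i, α i := by
  rw [Finset.abs_prod, ← Finset.prod_pow_eq_pow_sum]
  refine Finset.prod_le_prod (fun i _ => abs_nonneg _) fun i _ => ?_
  rw [abs_pow]
  exact pow_le_pow_left₀ (abs_nonneg _) (PiLp.norm_apply_le ξ i) _

lemma polyBddOn_monomial (α : Fin n → ℕ) :
    PolyBddOn univ fun (_ : ℝ) (ξ : EuclideanSpace ℝ (Fin n)) => ∏ i, ξ i ^ α i :=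
  ⟨1, ∑ i, α i, zero_le_one, fun _ _ ξ => by
    rw [one_mul]
    exact (abs_monomial_le α ξ).trans (pow_le_pow_left₀ (norm_nonneg _) (by linarith) _)⟩

lemma polyBddOn_monomial_div_norm {α : Fin n → ℕ} (hα : ∑ i, α i ≠ 0) :
    PolyBddOn univ fun (_ : ℝ) (ξ : EuclideanSpace ℝ (Fin n)) => (∏ i, ξ i ^ α i) / ‖ξ‖ := by
  obtain ⟨m, hm⟩ := Nat.exists_eq_succ_of_ne_zero hα
  refine ⟨1, m, zero_le_one, fun _ _ ξ => ?_⟩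
  rw [one_mul, abs_div, abs_norm]
  refine div_le_of_le_mul₀ (norm_nonneg _) (by positivity) ((abs_monomial_le α ξ).trans ?_)
  rw [hm, pow_succ]
  gcongr
  linarith

lemma monomial_eq_norm_mul {α : Fin n → ℕ} (hα : ∑ i, α i ≠ 0) (ξ : EuclideanSpace ℝ (Fin n)) :
    ∏ i, ξ i ^ α i = ‖ξ‖ * ((∏ i, ξ i ^ α i) / ‖ξ‖) := by
  rcases eq_or_ne ‖ξ‖ 0 with hξ | hξ
  · have hzero := abs_monomial_le α ξ
    rw [hξ, zero_pow hα] at hzero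
    rw [hξ, zero_mul, abs_nonpos_iff.1 hzero]
  · field_simp

lemma coeffSum_eq_sum (a : Coeffs n) (j k : ℕ) :
    coeffSum a j k = ∑ α ∈ Finset.piAntidiag Finset.univ k,
      fun t ξ => a j α t * ((∏ i, ξ i ^ α i : ℝ) : ℂ) := by
  funext t ξ
  simp only [coeffSum, Finset.sum_apply, Complex.ofReal_prod, Complex.ofReal_pow]

lemma symCoeff_eq_sum (a : Coeffs n) (j : ℕ) :
    symCoeff a j = ∑ α ∈ Finset.piAntidiag Finset.univ (3 - j),
      fun t ξ => (a j α t).re * ∏ i, ξ i ^ α i := by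
  funext t ξ
  simp only [symCoeff, coeffSum_eq_sum, Finset.sum_apply, Complex.re_sum, Complex.re_mul_ofReal]

lemma analyticOnNhd_of_mem_piAntidiag (ha : AnalyticCoeffs a T) (hj : j ≤ 2) (hjk : j + k ≤ 3)
    {α : Fin n → ℕ} (hα : α ∈ Finset.piAntidiag Finset.univ k) :
    AnalyticOnNhd ℝ (a j α) (Icc 0 T) :=
  ha j α hj (by rwa [(Finset.mem_piAntidiag.1 hα).1])

lemma analyticOnNhd_coeffSum (ha : AnalyticCoeffs a T) (hj : j ≤ 2) (hjk : j + k ≤ 3)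
    (ξ : EuclideanSpace ℝ (Fin n)) :
    AnalyticOnNhd ℝ (fun t => coeffSum a j k t ξ) (Icc 0 T) :=
  Finset.analyticOnNhd_fun_sum _ fun _ hα =>
    (analyticOnNhd_of_mem_piAntidiag ha hj hjk hα).mul analyticOnNhd_const

lemma analyticOnNhd_re {f : ℝ → ℂ} {s : Set ℝ} (hf : AnalyticOnNhd ℝ f s) :
    AnalyticOnNhd ℝ (fun t => (f t).re) s :=
  (Complex.reCLM.analyticOnNhd univ).comp hf (mapsTo_univ _ _)

lemma analyticOnNhd_im {f : ℝ → ℂ} {s : Set ℝ} (hf : AnalyticOnNhd ℝ f s) :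
    AnalyticOnNhd ℝ (fun t => (f t).im) s :=
  (Complex.imCLM.analyticOnNhd univ).comp hf (mapsTo_univ _ _)

lemma symCoeff_mem_coeffModule (ha : AnalyticCoeffs a T) (hj : j ≤ 2) :
    symCoeff a j ∈ coeffModule (EuclideanSpace ℝ (Fin n)) T := by
  rw [symCoeff_eq_sum]
  refine sum_mem fun α hα => ?_
  have hdeg : ∑ i, α i ≠ 0 := by
    rw [(Finset.mem_piAntidiag.1 hα).1]
    omega
  exact mul_mem_coeffModule
    (analyticOnNhd_re (analyticOnNhd_of_mem_piAntidiag ha hj (by omega) hα))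
    (polyBddOn_monomial_div_norm hdeg) (monomial_eq_norm_mul hdeg)

lemma coeffSum_mem_complexify {A : Subalgebra ℝ (ℝ → EuclideanSpace ℝ (Fin n) → ℝ)}
    (hA : sepAlg (EuclideanSpace ℝ (Fin n)) T ≤ A) (ha : AnalyticCoeffs a T) (hj : j ≤ 2)
    (hjk : j + k ≤ 3) : coeffSum a j k ∈ complexify A := by
  rw [coeffSum_eq_sum]
  refine sum_mem fun α hα => ?_
  have han := analyticOnNhd_of_mem_piAntidiag ha hj hjk hα
  constructor
  · simpa only [Complex.re_mul_ofReal] using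
      hA (mem_sepAlg_of_analyticOnNhd (analyticOnNhd_re han) (polyBddOn_monomial α))
  · simpa only [Complex.im_mul_ofReal] using
      hA (mem_sepAlg_of_analyticOnNhd (analyticOnNhd_im han) (polyBddOn_monomial α))

end Coefficients

section AuxiliaryRoots

variable {n : ℕ} {a : Coeffs n} {T : ℝ}

lemma prodDiff_three {R : Type*} [CommRing R] (x : Fin 3 → R) :
    prodDiff x = -((x 0 - x 1) ^ 2 * (x 1 - x 2) ^ 2 * (x 2 - x 0) ^ 2) := by
  have h₀ : Finset.univ.erase (0 : Fin 3) = {1, 2} := by decide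
  have h₁ : Finset.univ.erase (1 : Fin 3) = {0, 2} := by decide
  have h₂ : Finset.univ.erase (2 : Fin 3) = {0, 1} := by decide
  rw [prodDiff, Fin.prod_univ_three, h₀, h₁, h₂, Finset.prod_pair (by decide),
    Finset.prod_pair (by decide), Finset.prod_pair (by decide)]
  ring

lemma prodDiff_two {R : Type*} [CommRing R] (x : Fin 2 → R) :
    prodDiff x = -(x 0 - x 1) ^ 2 := by
  have h₀ : Finset.univ.erase (0 : Fin 2) = {1} := by decide
  have h₁ : Finset.univ.erase (1 : Fin 2) = {0} := by decide
  rw [prodDiff, Fin.prod_univ_two, h₀, h₁, Finset.prod_singleton, Finset.prod_singleton]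
  ring

/-- The coefficients of the monic cubic polynomial `L - ∂_τ² L`, constant term first. -/
def lamCoeff (a : Coeffs n) : Fin 3 → ℝ → EuclideanSpace ℝ (Fin n) → ℝ :=
  ![symCoeff a 0 - (2 : ℝ) • symCoeff a 2, symCoeff a 1 - fun _ _ => 6, symCoeff a 2]

/-- The coefficients of the monic quadratic polynomial `∂_τ (L - ∂_τ² L) / 3`, constant term
first. -/
def muCoeff (a : Coeffs n) : Fin 2 → ℝ → EuclideanSpace ℝ (Fin n) → ℝ :=
  ![(1 / 3 : ℝ) • lamCoeff a 1, (2 / 3 : ℝ) • lamCoeff a 2]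

lemma lamCoeff_mem_coeffModule (ha : AnalyticCoeffs a T) (i : Fin 3) :
    lamCoeff a i ∈ coeffModule (EuclideanSpace ℝ (Fin n)) T := by
  have h₀ := symCoeff_mem_coeffModule ha zero_le_two
  have h₁ := symCoeff_mem_coeffModule ha one_le_two
  have h₂ := symCoeff_mem_coeffModule ha le_rfl
  fin_cases i
  · exact sub_mem h₀ (Submodule.smul_mem _ 2 h₂)
  · exact sub_mem h₁ (const_mem_coeffModule 6)
  · exact h₂

lemma muCoeff_mem_coeffModule (ha : AnalyticCoeffs a T) (i : Fin 2) :
    muCoeff a i ∈ coeffModule (EuclideanSpace ℝ (Fin n)) T := by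
  fin_cases i
  · exact Submodule.smul_mem _ _ (lamCoeff_mem_coeffModule ha 1)
  · exact Submodule.smul_mem _ _ (lamCoeff_mem_coeffModule ha 2)

lemma prodDiff_lam_mem_sepAlg (ha : AnalyticCoeffs a T) (hL : WeaklyHyperbolic a T) :
    prodDiff (lam a) ∈ sepAlg (EuclideanSpace ℝ (Fin n)) T := by
  let b : sepAlg (EuclideanSpace ℝ (Fin n)) T := ⟨_, (lamCoeff_mem_coeffModule ha 2).2.1⟩
  let c : sepAlg (EuclideanSpace ℝ (Fin n)) T := ⟨_, (lamCoeff_mem_coeffModule ha 1).2.1⟩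
  let d : sepAlg (EuclideanSpace ℝ (Fin n)) T := ⟨_, (lamCoeff_mem_coeffModule ha 0).2.1⟩
  refine mem_congr_of_sepAlg_le le_rfl
    (4 * c ^ 3 + 4 * b ^ 3 * d + 27 * d ^ 2 - b ^ 2 * c ^ 2 - 18 * b * c * d).2 fun t ht ξ => ?_
  obtain ⟨hb, hc, hd⟩ := lam_vieta hL (Ioo_subset_Icc_self ht) ξ
  change prodDiff (lam a) t ξ = 4 * (symCoeff a 1 t ξ - 6) ^ 3 +
    4 * symCoeff a 2 t ξ ^ 3 * (symCoeff a 0 t ξ - 2 * symCoeff a 2 t ξ) +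
    27 * (symCoeff a 0 t ξ - 2 * symCoeff a 2 t ξ) ^ 2 -
    symCoeff a 2 t ξ ^ 2 * (symCoeff a 1 t ξ - 6) ^ 2 - 18 * symCoeff a 2 t ξ *
      (symCoeff a 1 t ξ - 6) * (symCoeff a 0 t ξ - 2 * symCoeff a 2 t ξ)
  rw [hd, hc, hb, prodDiff_three]
  simp only [Pi.neg_apply, Pi.mul_apply, Pi.pow_apply, Pi.sub_apply]
  ring

lemma prodDiff_mu_mem_sepAlg (ha : AnalyticCoeffs a T) (hL : WeaklyHyperbolic a T) :
    prodDiff (mu a) ∈ sepAlg (EuclideanSpace ℝ (Fin n)) T := by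
  have hb := (lamCoeff_mem_coeffModule ha 2).2.1
  have hc := (lamCoeff_mem_coeffModule ha 1).2.1
  refine mem_congr_of_sepAlg_le le_rfl (Subalgebra.smul_mem _
    (sub_mem (pow_mem hb 2) (Subalgebra.smul_mem _ hc 3)) (-(4 / 9))) fun t ht ξ => ?_
  change prodDiff (mu a) t ξ =
    -(4 / 9) * (symCoeff a 2 t ξ ^ 2 - 3 * (symCoeff a 1 t ξ - 6))
  rw [prodDiff_two, neg_mul, ← mu_sub_sq hL (Ioo_subset_Icc_self ht)]
  rfl

theorem isRootFamily_lam (ha : AnalyticCoeffs a T) (hL : WeaklyHyperbolic a T) :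
    IsRootFamily T (lamCoeff a) (lam a) where
  coeff_mem := lamCoeff_mem_coeffModule ha
  strictMono _ ht ξ := lam_strictMono hL ht ξ
  prod_eq t ht ξ z := by
    obtain ⟨h₂, h₁, h₀⟩ := lam_vieta hL ht ξ
    simp only [lamCoeff, Fin.prod_univ_three, Fin.sum_univ_three, Matrix.cons_val, Pi.sub_apply,
      Pi.smul_apply, smul_eq_mul, Fin.coe_ofNat_eq_mod]
    linear_combination -h₀ - z * h₁ - z ^ 2 * h₂
  prodDiff_mem := prodDiff_lam_mem_sepAlg ha hL
  exists_le_abs_prodDiff := ⟨864, by norm_num, fun t ht ξ => by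
    rw [prodDiff_three, Pi.neg_apply, Pi.neg_apply, abs_neg]
    exact (lam_gaps hL (Ioo_subset_Icc_self ht) ξ).2.2.2.trans (le_abs_self _)⟩

theorem isRootFamily_mu (ha : AnalyticCoeffs a T) (hL : WeaklyHyperbolic a T) :
    IsRootFamily T (muCoeff a) (mu a) where
  coeff_mem := muCoeff_mem_coeffModule ha
  strictMono _ ht ξ := mu_strictMono hL ht ξ
  prod_eq t ht ξ z := by
    obtain ⟨hadd, hmul⟩ := mu_vieta hL ht ξ
    simp only [muCoeff, lamCoeff, Fin.prod_univ_two, Fin.sum_univ_two, Matrix.cons_val,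
      Pi.sub_apply, Pi.smul_apply, smul_eq_mul, Fin.coe_ofNat_eq_mod]
    linear_combination -(hmul / 3) - z * hadd / 3
  prodDiff_mem := prodDiff_mu_mem_sepAlg ha hL
  exists_le_abs_prodDiff := ⟨8, by norm_num, fun t ht ξ => by
    have hsq := mu_sub_sq hL (Ioo_subset_Icc_self ht) ξ
    have hdiscr := symCoeff_discrim_ge hL (Ioo_subset_Icc_self ht) ξ
    rw [prodDiff_two, Pi.neg_apply, Pi.neg_apply, abs_neg]
    refine le_trans ?_ (le_abs_self _)
    change 8 ≤ (mu a 0 t ξ - mu a 1 t ξ) ^ 2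
    linarith⟩

theorem rootsRegular (ha : AnalyticCoeffs a T) (hL : WeaklyHyperbolic a T) : RootsRegular a T :=
  fun ξ => ⟨fun _ ht => ⟨auxL_eq_prod hL ht ξ, lam_strictMono hL ht ξ (by decide),
    lam_strictMono hL ht ξ (by decide), derivative_auxL_eq_prod hL ht ξ,
    mu_strictMono hL ht ξ (by decide)⟩, fun j => (isRootFamily_lam ha hL).analyticOn j ξ,
    fun j => (isRootFamily_mu ha hL).analyticOn j ξ⟩

end AuxiliaryRoots

section LowerOrder

open Polynomial

variable {n : ℕ} {a : Coeffs n} {T t : ℝ}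

lemma eval_symM (a : Coeffs n) (t : ℝ) (ξ : EuclideanSpace ℝ (Fin n)) (τ : ℂ) :
    (symM a t ξ).eval τ =
      coeffSum a 2 0 t ξ * τ ^ 2 + coeffSum a 1 1 t ξ * τ + coeffSum a 0 2 t ξ := by
  simp only [symM, Finset.sum_range_succ, Finset.range_zero, Finset.sum_empty, Nat.sub_zero,
    Nat.reduceSub, Nat.sub_self, eval_add, eval_mul, eval_C, eval_pow, eval_X, eval_zero]
  ring

lemma eval_derivative_symM (a : Coeffs n) (t : ℝ) (ξ : EuclideanSpace ℝ (Fin n)) (τ : ℂ) :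
    (derivative (symM a t ξ)).eval τ = 2 * τ * coeffSum a 2 0 t ξ + coeffSum a 1 1 t ξ := by
  simp only [symM, Finset.sum_range_succ, Finset.range_zero, Finset.sum_empty, Nat.sub_zero,
    Nat.reduceSub, Nat.sub_self, derivative_add, derivative_C_mul_X_pow, derivative_zero, eval_add,
    eval_C_mul, eval_pow, eval_X, eval_zero, Nat.cast_zero, Nat.cast_one, Nat.cast_ofNat]
  ring

lemma eval_symN (a : Coeffs n) (t : ℝ) (ξ : EuclideanSpace ℝ (Fin n)) (τ : ℂ) :
    (symN a t ξ).eval τ = coeffSum a 1 0 t ξ * τ + coeffSum a 0 1 t ξ := by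
  simp only [symN, Finset.sum_range_succ, Finset.range_zero, Finset.sum_empty, Nat.sub_zero,
    Nat.sub_self, eval_add, eval_mul, eval_C, eval_pow, eval_X, eval_zero]
  ring

lemma eval_derivative_symL (a : Coeffs n) (t : ℝ) (ξ : EuclideanSpace ℝ (Fin n)) (τ : ℂ) :
    (derivative (symL a t ξ)).eval τ =
      3 * τ ^ 2 + 2 * τ * coeffSum a 2 1 t ξ + coeffSum a 1 2 t ξ := by
  simp only [derivative_symL_eq, eval_add, eval_mul, eval_C, eval_pow, eval_X, eval_ofNat]
  ring

lemma eval_derivative_derivative_symL (a : Coeffs n) (t : ℝ) (ξ : EuclideanSpace ℝ (Fin n))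
    (τ : ℂ) :
    (derivative (derivative (symL a t ξ))).eval τ = 6 * τ + 2 * coeffSum a 2 1 t ξ := by
  simp only [derivative_derivative_symL_eq, eval_add, eval_mul, eval_C, eval_X, eval_ofNat]

lemma hasDerivAt_coeffSum (ha : AnalyticCoeffs a T) (ht : t ∈ Icc 0 T)
    (ξ : EuclideanSpace ℝ (Fin n)) (j k : ℕ) (hj : j ≤ 2) (hjk : j + k ≤ 3) :
    HasDerivAt (fun s => coeffSum a j k s ξ) (dt (coeffSum a j k) t ξ) t :=
  (analyticOnNhd_coeffSum ha hj hjk ξ t ht).differentiableAt.hasDerivAt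

lemma checkM_eq (ha : AnalyticCoeffs a T) (ht : t ∈ Icc 0 T) (τ : ℂ)
    (ξ : EuclideanSpace ℝ (Fin n)) :
    checkM a t τ ξ = coeffSum a 2 0 t ξ * τ ^ 2 + coeffSum a 1 1 t ξ * τ + coeffSum a 0 2 t ξ -
      dt (coeffSum a 2 1) t ξ * τ - 1 / 2 * dt (coeffSum a 1 2) t ξ := by
  have h₂ := (hasDerivAt_coeffSum ha ht ξ 2 1 le_rfl le_rfl).const_mul (2 * τ)
  have hderiv := (h₂.const_add (3 * τ ^ 2)).fun_add
    (hasDerivAt_coeffSum ha ht ξ 1 2 one_le_two le_rfl)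
  rw [checkM, eval_symM]
  simp only [eval_derivative_symL, hderiv.deriv]
  ring

lemma checkN_eq (ha : AnalyticCoeffs a T) (ht : t ∈ Icc 0 T) (τ : ℂ)
    (ξ : EuclideanSpace ℝ (Fin n)) :
    checkN a t τ ξ = coeffSum a 1 0 t ξ * τ + coeffSum a 0 1 t ξ - dt (coeffSum a 2 0) t ξ * τ -
      1 / 2 * dt (coeffSum a 1 1) t ξ + 1 / 6 * dt (dt (coeffSum a 2 1)) t ξ := by
  have h₂ := (hasDerivAt_coeffSum ha ht ξ 2 0 le_rfl (Nat.le_succ 2)).const_mul (2 * τ)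
  have hderiv := h₂.fun_add (hasDerivAt_coeffSum ha ht ξ 1 1 one_le_two (Nat.le_succ 2))
  have hderiv₂ : iteratedDeriv 2 (fun s => 6 * τ + 2 * coeffSum a 2 1 s ξ) t =
      2 * dt (dt (coeffSum a 2 1)) t ξ := by
    rw [iteratedDeriv_succ, iteratedDeriv_one, deriv_const_add', deriv_const_mul_field']
    exact deriv_const_mul_field 2
  rw [checkN, eval_symN]
  simp only [eval_derivative_symM, eval_derivative_derivative_symL, hderiv.deriv, hderiv₂]
  ring

variable {A : Subalgebra ℝ (ℝ → EuclideanSpace ℝ (Fin n) → ℝ)}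
  {x : ℝ → EuclideanSpace ℝ (Fin n) → ℝ}

lemma IsTameAlgebra.checkM_mem_complexify (hA : IsTameAlgebra T A) (ha : AnalyticCoeffs a T)
    (hx : x ∈ A) : (fun t ξ => checkM a t (x t ξ) ξ) ∈ complexify A := by
  have hsep := sepAlg_le_fracAlg.trans hA.fracAlg_le
  have hx' := ofReal_mem_complexify hx
  have hdt (j k : ℕ) (hj : j ≤ 2) (hjk : j + k ≤ 3) : dt (coeffSum a j k) ∈ complexify A :=
    hA.dt_mem_complexify (coeffSum_mem_complexify hsep ha hj hjk)
  have hsymM : (fun t ξ => coeffSum a 2 0 t ξ * (x t ξ : ℂ) ^ 2 + coeffSum a 1 1 t ξ * x t ξ +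
      coeffSum a 0 2 t ξ) ∈ complexify A :=
    add_mem (add_mem
      (mul_mem (coeffSum_mem_complexify hsep ha le_rfl (by norm_num)) (pow_mem hx' 2))
      (mul_mem (coeffSum_mem_complexify hsep ha one_le_two (by norm_num)) hx'))
      (coeffSum_mem_complexify hsep ha zero_le_two (by norm_num))
  refine mem_complexify_congr hsep (sub_mem (sub_mem hsymM (mul_mem (hdt 2 1 le_rfl le_rfl) hx'))
    (Subalgebra.smul_mem _ (hdt 1 2 one_le_two le_rfl) (1 / 2))) fun t ht ξ => ?_
  rw [checkM_eq ha (Ioo_subset_Icc_self ht)]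
  simp [Complex.real_smul]

lemma IsTameAlgebra.checkN_mem_complexify (hA : IsTameAlgebra T A) (ha : AnalyticCoeffs a T)
    (hx : x ∈ A) : (fun t ξ => checkN a t (x t ξ) ξ) ∈ complexify A := by
  have hsep := sepAlg_le_fracAlg.trans hA.fracAlg_le
  have hx' := ofReal_mem_complexify hx
  have hdt (j k : ℕ) (hj : j ≤ 2) (hjk : j + k ≤ 3) : dt (coeffSum a j k) ∈ complexify A :=
    hA.dt_mem_complexify (coeffSum_mem_complexify hsep ha hj hjk)
  have hsymN : (fun t ξ => coeffSum a 1 0 t ξ * (x t ξ : ℂ) + coeffSum a 0 1 t ξ) ∈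
      complexify A :=
    add_mem (mul_mem (coeffSum_mem_complexify hsep ha one_le_two (by norm_num)) hx')
      (coeffSum_mem_complexify hsep ha zero_le_two (by norm_num))
  refine mem_complexify_congr hsep (add_mem (sub_mem
    (sub_mem hsymN (mul_mem (hdt 2 0 le_rfl (Nat.le_succ 2)) hx'))
    (Subalgebra.smul_mem _ (hdt 1 1 one_le_two (Nat.le_succ 2)) (1 / 2)))
    (Subalgebra.smul_mem _ (hA.dt_mem_complexify (hdt 2 1 le_rfl le_rfl)) (1 / 6)))
    fun t ht ξ => ?_
  rw [checkN_eq ha (Ioo_subset_Icc_self ht)]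
  simp [Complex.real_smul]

end LowerOrder

section Integrands

variable {n : ℕ} {a : Coeffs n} {T : ℝ}

theorem logCondition_integrand1 (hT : 0 < T) (ha : AnalyticCoeffs a T)
    (hL : WeaklyHyperbolic a T) : LogCondition T univ (integrand1 a) :=
  LogCondition.sum hT.le S2 fun _ hp => (isRootFamily_lam ha hL).logCondition_logDeriv_sub hT
    fun _ ht ξ => one_le_abs_lam_sub hL (Ioo_subset_Icc_self ht) ξ hp

theorem logCondition_integrand2 (hT : 0 < T) (ha : AnalyticCoeffs a T)
    (hL : WeaklyHyperbolic a T) : LogCondition T univ (integrand2 a) := by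
  have hsum := LogCondition.sum hT.le S2 fun p _ =>
    (isRootFamily_lam ha hL).logCondition_dt_dt_sub hT p.1 p.2
  refine hsum.congr hT.le fun t _ ξ _ => ?_
  simp only [integrand2, iteratedDeriv_succ, iteratedDeriv_zero]
  rfl

theorem logCondition_integrand3 (hT : 0 < T) (ha : AnalyticCoeffs a T)
    (hL : WeaklyHyperbolic a T) {R : ℝ} (hR : 0 < R) :
    LogCondition T {ξ | R ≤ ‖ξ‖} (integrand3 a) :=
  have hA := (isRootFamily_lam ha hL).isTameAlgebra
  LogCondition.sum hT.le Finset.univ fun j _ => (hA.logBdd_of_mem_complexify hT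
    (hA.checkM_mem_complexify ha (mem_rootAlg j))).logCondition_of_le hR

theorem logCondition_integrand4 (hT : 0 < T) (ha : AnalyticCoeffs a T)
    (hL : WeaklyHyperbolic a T) {R : ℝ} (hR : 0 < R) :
    LogCondition T {ξ | R ≤ ‖ξ‖} (integrand4 a) :=
  have hA := (isRootFamily_mu ha hL).isTameAlgebra
  LogCondition.sum hT.le Finset.univ fun j _ => (hA.logBdd_of_mem_complexify hT
    (hA.checkN_mem_complexify ha (mem_rootAlg j))).logCondition_of_le hR

end Integrands

end ThirdOrder

end

theorem mainTheorem3 (n : ℕ) (T : ℝ) (hT : 0 < T) (a : ThirdOrder.Coeffs n)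
    (ha : ThirdOrder.AnalyticCoeffs a T) (hL : ThirdOrder.WeaklyHyperbolic a T) :
    ThirdOrder.RootsRegular a T ∧
    ThirdOrder.LogCondition T Set.univ (ThirdOrder.integrand1 a) ∧
    ThirdOrder.LogCondition T Set.univ (ThirdOrder.integrand2 a) ∧
    (∀ R : ℝ, 0 < R →
      ThirdOrder.LogCondition T {ξ | R ≤ ‖ξ‖} (ThirdOrder.integrand3 a)) ∧
    (∀ R : ℝ, 0 < R →
      ThirdOrder.LogCondition T {ξ | R ≤ ‖ξ‖} (ThirdOrder.integrand4 a)) :=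
  ⟨ThirdOrder.rootsRegular ha hL, ThirdOrder.logCondition_integrand1 hT ha hL,
    ThirdOrder.logCondition_integrand2 hT ha hL,
    fun _ hR => ThirdOrder.logCondition_integrand3 hT ha hL hR,
    fun _ hR => ThirdOrder.logCondition_integrand4 hT ha hL hR⟩
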